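/- Let $d\ge 2$, $m\ge 1$ be integers and let $\Omega\subset\mathbb R^d$ be a bounded domain (a non-empty bounded connected open set). Let $H^m(\Omega)$ be the space of complex-valued $u\in L^2(\Omega)$ whose weak derivatives up to order $m$ are in $L^2(\Omega)$, with the norm $\|u\|_{H^m(\Omega)}^2=\int_\Omega |D^mu|^2+|u|^2\,dx$, where $D^mu\cdot D^mv=\sum_{j_1,\dots,j_m=1}^d(\partial^m_{j_1\cdots j_m}u)\overline{(\partial^m_{j_1\cdots j_m}v)}$ and $|D^mu|^2=D^mu\cdot D^mu$. Let $H^m_0(\Omega)$ be the closure of $C_c^\infty(\Omega)$ in $H^m(\Omega)$. Assume that the embedding $H^m(\Omega)\subset L^2(\Omega)$ is compact. For $H=H^m_0(\Omega)$ or $H=H^m(\Omega)$, a pair $(u,\Lambda)\in H\times\mathbb R$ with $u\neq0$ is an eigenpair if $\int_\Omega D^mu\cdot D^m\phi\,dx=\Lambda\int_\Omega u\bar\phi\,dx$ for all $\phi\in H$. A sequence $\Lambda_1\le\Lambda_2\le\cdots\to+\infty$ is called the sequence of eigenvalues on $H$, repeated according to multiplicity, if there is an orthonormal basis $(e_n)_{n\ge1}$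 of $L^2(\Omega)$ such that each $(e_n,\Lambda_n)$ is an eigenpair; such a sequence is unique if it exists. Then: 1. The sequence of Dirichlet eigenvalues $(\lambda^m_k)_{k\ge1}$ of $(-\Delta)^m$, the case $H=H^m_0(\Omega)$, exists. 2. If $H^m(\Omega)$ is complete for the above norm, then the sequence of Neumann eigenvalues $(\mu^m_k)_{k\ge1}$ of $(-\Delta)^m$, the case $H=H^m(\Omega)$, exists. 3. Whenever the sequence of Neumann eigenvalues exists, $$\mu_{k+m}^m<\lambda_k^m\qquad\text{for all integers } k\ge1.$$ -/

import Mathlib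

open MeasureTheory TopologicalSpace Filter
open scoped Distributions InnerProductSpace

namespace Polyharmonic

/-- The space `L²(Ω)` of complex valued functions on an open set `Ω ⊆ ℝ^d`. -/
abbrev L2 {d : ℕ} (Ω : Opens (EuclideanSpace ℝ (Fin d))) : Type :=
  Lp ℂ 2 (volume.restrict (Ω : Set (EuclideanSpace ℝ (Fin d))))

/-- The classical derivative `∂_{J 0} ∂_{J 1} ⋯ ∂_{J (n-1)} φ` of a function on `ℝ^d`. -/
noncomputable def partialDeriv {d n : ℕ} (J : Fin n → Fin d)
    (φ : EuclideanSpace ℝ (Fin d) → ℂ) (x : EuclideanSpace ℝ (Fin d)) : ℂ :=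
  iteratedFDeriv ℝ n φ x (fun i => EuclideanSpace.single (J i) (1 : ℝ))

/-- `v` is the weak derivative `∂_{J 0} ⋯ ∂_{J (n-1)} u` of `u` on `Ω`; the test functions
`φ ∈ 𝓓(Ω, ℂ)` are the smooth functions with compact support in `Ω`. -/
def HasWeakDeriv {d n : ℕ} {Ω : Opens (EuclideanSpace ℝ (Fin d))} (J : Fin n → Fin d)
    (u v : L2 Ω) : Prop :=
  ∀ φ : 𝓓(Ω, ℂ), ∫ x in (Ω : Set (EuclideanSpace ℝ (Fin d))), u x * partialDeriv J φ x =
    (-1) ^ n * ∫ x in (Ω : Set (EuclideanSpace ℝ (Fin d))), v x * φ x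

section Linearity

variable {d n : ℕ} {Ω : Opens (EuclideanSpace ℝ (Fin d))} {J : Fin n → Fin d}

lemma continuous_partialDeriv (J : Fin n → Fin d) (φ : 𝓓(Ω, ℂ)) :
    Continuous (partialDeriv J φ) := by
  have h : ContDiff ℝ ((⊤ : ℕ∞) : WithTop ℕ∞) φ := φ.contDiff
  have h2 : Continuous (iteratedFDeriv ℝ n φ) :=
    h.continuous_iteratedFDeriv (by exact_mod_cast le_top)
  unfold partialDeriv
  fun_prop

lemma hasCompactSupport_partialDeriv (J : Fin n → Fin d) (φ : 𝓓(Ω, ℂ)) :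
    HasCompactSupport (partialDeriv J φ) := by
  have h : HasCompactSupport (iteratedFDeriv ℝ n φ) := φ.hasCompactSupport.iteratedFDeriv n
  exact h.comp_left (g := fun L => L (fun i => EuclideanSpace.single (J i) (1 : ℝ))) rfl

lemma integrable_mul (u : L2 Ω) {ψ : EuclideanSpace ℝ (Fin d) → ℂ} (hψ : Continuous ψ)
    (hc : HasCompactSupport ψ) :
    Integrable (fun x => u x * ψ x)
      (volume.restrict (Ω : Set (EuclideanSpace ℝ (Fin d)))) :=
  have h : MemLp ψ 2 (volume.restrict (Ω : Set (EuclideanSpace ℝ (Fin d)))) :=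
    hψ.memLp_of_hasCompactSupport hc
  (Lp.memLp u).integrable_mul h

lemma HasWeakDeriv.zero : HasWeakDeriv J (0 : L2 Ω) 0 := by
  intro φ
  have key (ψ : EuclideanSpace ℝ (Fin d) → ℂ) :
      ∫ x in (Ω : Set (EuclideanSpace ℝ (Fin d))), (0 : L2 Ω) x * ψ x = 0 := by
    refine integral_eq_zero_of_ae ?_
    filter_upwards [Lp.coeFn_zero ℂ 2
      (volume.restrict (Ω : Set (EuclideanSpace ℝ (Fin d))))] with x hx
    rw [hx, Pi.zero_apply, zero_mul]
  rw [key, key, mul_zero]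

lemma HasWeakDeriv.add {u v u' v' : L2 Ω} (h : HasWeakDeriv J u v) (h' : HasWeakDeriv J u' v') :
    HasWeakDeriv J (u + u') (v + v') := by
  intro φ
  have key (a b : L2 Ω) {ψ : EuclideanSpace ℝ (Fin d) → ℂ} (hψ : Continuous ψ)
      (hc : HasCompactSupport ψ) :
      ∫ x in (Ω : Set (EuclideanSpace ℝ (Fin d))), (a + b : L2 Ω) x * ψ x =
        (∫ x in (Ω : Set (EuclideanSpace ℝ (Fin d))), a x * ψ x) +
        ∫ x in (Ω : Set (EuclideanSpace ℝ (Fin d))), b x * ψ x := by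
    rw [← integral_add (integrable_mul a hψ hc) (integrable_mul b hψ hc)]
    refine integral_congr_ae ?_
    filter_upwards [Lp.coeFn_add a b] with x hx
    rw [hx, Pi.add_apply, add_mul]
  rw [key _ _ (continuous_partialDeriv J φ) (hasCompactSupport_partialDeriv J φ),
    key _ _ φ.contDiff.continuous φ.hasCompactSupport, h φ, h' φ, mul_add]

lemma HasWeakDeriv.smul (c : ℂ) {u v : L2 Ω} (h : HasWeakDeriv J u v) :
    HasWeakDeriv J (c • u) (c • v) := by
  intro φ
  have key (a : L2 Ω) (ψ : EuclideanSpace ℝ (Fin d) → ℂ) :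
      ∫ x in (Ω : Set (EuclideanSpace ℝ (Fin d))), (c • a : L2 Ω) x * ψ x =
        c * ∫ x in (Ω : Set (EuclideanSpace ℝ (Fin d))), a x * ψ x := by
    rw [← integral_const_mul]
    refine integral_congr_ae ?_
    filter_upwards [Lp.coeFn_smul c a] with x hx
    rw [hx, Pi.smul_apply, smul_eq_mul, mul_assoc]
  rw [key, key, h φ]
  ring

end Linearity

/-- The Hilbert space of pairs `(u, (v_J)_J)` of a function `u ∈ L²(Ω)` and an array of functions
`v_J ∈ L²(Ω)` indexed by `J = (j_1, …, j_m)`, with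
`⟨(u, v), (u', v')⟩ = ⟨u, u'⟩ + ∑ J, ⟨v_J, v'_J⟩`. -/
abbrev Jet {d : ℕ} (Ω : Opens (EuclideanSpace ℝ (Fin d))) (m : ℕ) : Type :=
  WithLp 2 (L2 Ω × PiLp 2 (fun _ : Fin m → Fin d => L2 Ω))

/-- The Sobolev space `H^m(Ω)` of the functions `u ∈ L²(Ω)` all of whose weak derivatives of
order at most `m` are in `L²(Ω)`. An element is recorded as the pair `(u, D^m u)`, where `D^m u`
is the array of the weak derivatives of order exactly `m` (these are determined by `u`). The inner
product and the norm inherited from `Jet Ω m` are those of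
`∫_Ω D^m u · D^m v + u v̄` and `‖u‖² = ∫_Ω |D^m u|² + |u|²`. -/
noncomputable def Sobolev {d : ℕ} (Ω : Opens (EuclideanSpace ℝ (Fin d))) (m : ℕ) :
    Submodule ℂ (Jet Ω m) where
  carrier := {w | (∀ J : Fin m → Fin d, HasWeakDeriv J w.fst (w.snd J)) ∧
    ∀ n ≤ m, ∀ J : Fin n → Fin d, ∃ v : L2 Ω, HasWeakDeriv J w.fst v}
  zero_mem' := ⟨fun _ => HasWeakDeriv.zero, fun _ _ _ => ⟨0, HasWeakDeriv.zero⟩⟩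
  add_mem' := fun ha hb => ⟨fun J => (ha.1 J).add (hb.1 J), fun n hn J => by
    obtain ⟨v, hv⟩ := ha.2 n hn J
    obtain ⟨v', hv'⟩ := hb.2 n hn J
    exact ⟨v + v', hv.add hv'⟩⟩
  smul_mem' := fun c _ ha => ⟨fun J => (ha.1 J).smul c, fun n hn J => by
    obtain ⟨v, hv⟩ := ha.2 n hn J
    exact ⟨c • v, hv.smul c⟩⟩

/-- The embedding `H^m(Ω) ⊂ L²(Ω)`, `u ↦ u`. -/
noncomputable def toL2 {d : ℕ} (Ω : Opens (EuclideanSpace ℝ (Fin d))) (m : ℕ) :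
    Sobolev Ω m →ₗ[ℂ] L2 Ω where
  toFun w := w.1.fst
  map_add' _ _ := rfl
  map_smul' _ _ := rfl

/-- The array `D^m u` of all weak derivatives of order `m` of `u ∈ H^m(Ω)`. -/
noncomputable def topDeriv {d : ℕ} (Ω : Opens (EuclideanSpace ℝ (Fin d))) (m : ℕ) :
    Sobolev Ω m →ₗ[ℂ] PiLp 2 (fun _ : Fin m → Fin d => L2 Ω) where
  toFun w := w.1.snd
  map_add' _ _ := rfl
  map_smul' _ _ := rfl

/-- The subspace of `H^m(Ω)` of the (classes of) smooth functions with compact support in `Ω`. -/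
noncomputable def testSubspace {d : ℕ} (Ω : Opens (EuclideanSpace ℝ (Fin d))) (m : ℕ) :
    Submodule ℂ (Sobolev Ω m) where
  carrier := {w | ∃ φ : 𝓓(Ω, ℂ),
    toL2 Ω m w =ᵐ[volume.restrict (Ω : Set (EuclideanSpace ℝ (Fin d)))] φ}
  zero_mem' := ⟨0, Lp.coeFn_zero ℂ 2 _⟩
  add_mem' := by
    rintro a b ⟨φ, hφ⟩ ⟨ψ, hψ⟩
    refine ⟨φ + ψ, ?_⟩
    rw [map_add]
    filter_upwards [hφ, hψ, Lp.coeFn_add (toL2 Ω m a) (toL2 Ω m b)] with x h1 h2 h3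
    rw [h3, Pi.add_apply, h1, h2]
    rfl
  smul_mem' := by
    rintro c a ⟨φ, hφ⟩
    refine ⟨c • φ, ?_⟩
    rw [map_smul]
    filter_upwards [hφ, Lp.coeFn_smul c (toL2 Ω m a)] with x h1 h2
    rw [h2, Pi.smul_apply, h1]
    rfl

/-- `H^m_0(Ω)`, the closure of `C_c^∞(Ω)` in `H^m(Ω)`. -/
noncomputable def Sobolev0 {d : ℕ} (Ω : Opens (EuclideanSpace ℝ (Fin d))) (m : ℕ) :
    Submodule ℂ (Sobolev Ω m) :=
  (testSubspace Ω m).topologicalClosure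

/-- `u ∈ H` solves `∫_Ω D^m u · D^m φ = Λ ∫_Ω u φ̄` for all `φ ∈ H`, where
`D^m u · D^m φ = ∑ J, ∂_J u * conj (∂_J φ)`. (Mathlib's inner product is conjugate linear in the
first argument.) -/
def IsWeakSolution {d m : ℕ} {Ω : Opens (EuclideanSpace ℝ (Fin d))}
    (H : Submodule ℂ (Sobolev Ω m)) (Λ : ℝ) (u : Sobolev Ω m) : Prop :=
  u ∈ H ∧ ∀ φ ∈ H, ⟪topDeriv Ω m φ, topDeriv Ω m u⟫_ℂ = (Λ : ℂ) * ⟪toL2 Ω m φ, toL2 Ω m u⟫_ℂ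

/-- `Λ 0 ≤ Λ 1 ≤ ⋯` is the sequence of the eigenvalues of the variational problem on `H`, repeated
according to multiplicity and diverging to `+∞`: there are eigenfunctions `e n ∈ H` for `Λ n`
which form an orthonormal basis of `L²(Ω)`. (Eigenfunctions for distinct eigenvalues are
orthogonal in `L²(Ω)`, so the eigenspace of any real `t` is the span of the finitely many `e n`
with `Λ n = t`, and the sequence `Λ` is determined by `H`.) -/
structure IsEigenvalueSequence {d m : ℕ} {Ω : Opens (EuclideanSpace ℝ (Fin d))}
    (H : Submodule ℂ (Sobolev Ω m)) (Λ : ℕ → ℝ) : Prop where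
  monotone : Monotone Λ
  tendsto : Tendsto Λ atTop atTop
  exists_basis : ∃ e : ℕ → Sobolev Ω m, (∀ n, IsWeakSolution H (Λ n) (e n)) ∧
    Orthonormal ℂ (fun n => toL2 Ω m (e n)) ∧
    (Submodule.span ℂ (Set.range fun n => toL2 Ω m (e n))).topologicalClosure = ⊤

/-- The Dirichlet eigenvalues of `(-Δ)^m` on `Ω`, counted from the index `0`. -/
def IsDirichletSpectrum {d : ℕ} (Ω : Opens (EuclideanSpace ℝ (Fin d))) (m : ℕ) (lam : ℕ → ℝ) :
    Prop :=
  IsEigenvalueSequence (Sobolev0 Ω m) lam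

/-- The Neumann eigenvalues of `(-Δ)^m` on `Ω`, counted from the index `0`. -/
def IsNeumannSpectrum {d : ℕ} (Ω : Opens (EuclideanSpace ℝ (Fin d))) (m : ℕ) (mu : ℕ → ℝ) :
    Prop :=
  IsEigenvalueSequence (⊤ : Submodule ℂ (Sobolev Ω m)) mu

end Polyharmonic

/-! The comparison is a min-max argument with an enlarged trial space. Put λ = `lam k` and suppose λ
≤ `mu (k + m)`. Let V be spanned by the first k + 1 Dirichlet eigenfunctions and, for a unit vector
θ, let W be spanned by the m exponentials exp(κ_j θ·x), where the κ_j are the roots of κ^m = i^m √λ.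
Each w in W solves (-Δ)^m w = λ w and satisfies |D^m w|² = λ|w|² pointwise
(`norm_sq_topDeriv_sum_expo`). Integration by parts against V ⊂ H^m_0 turns the cross term into λ⟨v,
w⟩ (`inner_topDeriv_expo`), so ‖D^m u‖² ≤ λ‖u‖² for every u = v + w.

The parameter space has dimension k + 1 + m, so some nonzero pair (v, w) is orthogonal to the first
k + m Neumann eigenfunctions. Equality in the variational bound then makes u a Neumann solution for
λ, lying in a fixed finite-dimensional space (`eigen_of_norm_sq_le`). The coefficients of w cannot
all vanish: otherwise v ∈ H^m_0 solves the Neumann problem, its extension by zero has Fourier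
transform supported on a sphere, and v = 0 (`toL2_eq_zero_of_dirichlet_of_neumann`). Since d ≥ 2
there are infinitely many directions θ. They give infinitely many independent sums of exponentials
inside one finite-dimensional space, a contradiction.

Existence of the spectra comes from the compact positive operator A A*, with A the embedding of H
into L². For H^m_0 the completeness of H follows from the Poincaré inequality. -/

namespace Polyharmonic

/-! ### Spectral theory of compact operators. -/

/-- An infinite family of reals with finite sublevel sets can be listed in increasing order. -/
theorem exists_equiv_nat_monotone {ι : Type*} [Infinite ι] (f : ι → ℝ)
    (hf : ∀ c, {i | f i ≤ c}.Finite) : ∃ σ : ℕ ≃ ι, Monotone (f ∘ σ) := by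
  have hc : Countable ι := by
    rw [← Set.countable_univ_iff]
    have : (Set.univ : Set ι) = ⋃ n : ℕ, {i | f i ≤ n} := by
      ext i
      simpa using exists_nat_ge (f i)
    rw [this]
    exact Set.countable_iUnion fun n => (hf n).countable
  obtain ⟨g, hg⟩ := hc.exists_injective_nat
  -- The predecessors of `i` for the order by `f`, with ties broken by `g`. Their number is an
  -- injective rank, and sorting by rank sorts by `f`.
  let P : ι → Set ι := fun i => {j | f j < f i ∨ (f j = f i ∧ g j < g i)}
  have hP : ∀ i, (P i).Finite := fun i => (hf (f i)).subset fun j hj => by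
    rcases hj with hj | hj
    · exact hj.le
    · exact hj.1.le
  have hlt : ∀ i j, j ∈ P i → (P j).ncard < (P i).ncard := fun i j hj => by
    refine Set.ncard_lt_ncard ⟨fun l hl => ?_, fun h => ?_⟩ (hP i)
    · simp only [P, Set.mem_ofPred_eq] at hl hj ⊢
      grind
    · have := h hj
      simp [P] at this
  have hinj : Function.Injective fun i => (P i).ncard := by
    intro i j hij
    by_contra hne
    have hne' : g i ≠ g j := fun h => hne (hg h)
    have : j ∈ P i ∨ i ∈ P j := by
      simp only [P, Set.mem_ofPred_eq]
      grind
    rcases this with h | h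
    · exact absurd hij (hlt _ _ h).ne'
    · exact absurd hij (hlt _ _ h).ne
  have : Infinite (Set.range fun i => (P i).ncard) :=
    (Set.infinite_range_of_injective hinj).to_subtype
  classical
  let o := Nat.Subtype.orderIsoOfNat (Set.range fun i => (P i).ncard)
  refine ⟨o.toEquiv.trans (Equiv.ofInjective _ hinj).symm, fun a b hab => ?_⟩
  by_contra! hcon
  have h1 := hlt _ _ (Or.inl hcon : _ ∈ P _)
  have h2 : ∀ n, (P ((o.toEquiv.trans (Equiv.ofInjective _ hinj).symm) n)).ncard = (o n : ℕ) :=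
    fun n => Equiv.apply_ofInjective_symm hinj (o n)
  rw [h2, h2] at h1
  have h3 : (o a : ℕ) ≤ o b := o.monotone hab
  omega

section

variable {G : Type*} [NormedAddCommGroup G] [InnerProductSpace ℂ G]

/-- A compact operator has only finitely many orthonormal eigenvectors with eigenvalues bounded
away from zero. -/
theorem finite_setOf_le_eigenvalue {ι : Type*} {T : G →L[ℂ] G} (hT : IsCompactOperator T)
    {v : ι → G} (hv : Orthonormal ℂ v) {ν : ι → ℝ} (hTv : ∀ i, T (v i) = (ν i : ℂ) • v i)
    {ε : ℝ} (hε : 0 < ε) : {i | ε ≤ ν i}.Finite := by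
  by_contra hinf
  have hinf : {i | ε ≤ ν i}.Infinite := hinf
  obtain ⟨K, hK, hKT⟩ := hT.image_closedBall_subset_compact (f := (T : G →ₗ[ℂ] G)) 1
  let s := hinf.natEmbedding
  have hmem : ∀ n, T (v (s n)) ∈ K := fun n => hKT ⟨v (s n), by simp [hv.1], rfl⟩
  obtain ⟨a, -, φ, hφ, ha⟩ := hK.tendsto_subseq hmem
  have hcau := ha.cauchySeq
  rw [Metric.cauchySeq_iff] at hcau
  obtain ⟨N, hN⟩ := hcau ε hε
  have h1 := hN N le_rfl (N + 1) (by omega)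
  have hne : (s (φ N) : ι) ≠ s (φ (N + 1)) := by
    intro h
    have := s.injective (Subtype.ext h)
    exact absurd this (hφ (Nat.lt_succ_self N)).ne
  have hin : ε ≤ ν (s (φ N)) := (s (φ N)).2
  -- Pairing with a unit vector shows that the images of distinct eigenvectors are at distance at
  -- least `ε`, so no subsequence is Cauchy.
  have key : ⟪v (s (φ N)), T (v (s (φ N))) - T (v (s (φ (N + 1))))⟫_ℂ = ν (s (φ N)) := by
    rw [hTv, hTv, inner_sub_right, inner_smul_right, inner_smul_right, hv.2 hne,
      inner_self_eq_norm_sq_to_K, hv.1]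
    simp
  have h3 := norm_inner_le_norm (𝕜 := ℂ) (v (s (φ N)))
    (T (v (s (φ N))) - T (v (s (φ (N + 1)))))
  rw [key, hv.1, one_mul, Complex.norm_real, ← dist_eq_norm] at h3
  have h4 := le_abs_self (ν (s (φ N)))
  simp only [Function.comp_apply, Real.norm_eq_abs] at h1 h3
  linarith

/-- The eigenvectors of a positive definite compact operator form an orthonormal basis, and the
inverses of the eigenvalues can be listed as an increasing sequence. -/
theorem exists_eigenbasis [CompleteSpace G] (hG : ¬ FiniteDimensional ℂ G) {T : G →L[ℂ] G}
    (hT : IsCompactOperator T) (hT' : (T : G →ₗ[ℂ] G).IsSymmetric)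
    (hpos : ∀ x, x ≠ 0 → 0 < (⟪x, T x⟫_ℂ).re) :
    ∃ (κ : ℕ → ℝ) (e : ℕ → G), Monotone κ ∧ Tendsto κ atTop atTop ∧
      (∀ n, (κ n : ℂ) • T (e n) = e n) ∧ Orthonormal ℂ e ∧
      (Submodule.span ℂ (Set.range e)).topologicalClosure = ⊤ := by
  let V : ℂ → Submodule ℂ G := fun μ => Module.End.eigenspace (T : G →ₗ[ℂ] G) μ
  have hV0 : V 0 = ⊥ := by
    rw [eq_bot_iff]
    intro x hx
    by_contra h0
    have h1 : T x = 0 := by simpa [V] using hx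
    have := hpos x h0
    simp [h1] at this
  have hfin : ∀ μ, FiniteDimensional ℂ (V μ) := fun μ => by
    by_cases hμ : μ = 0
    · subst hμ
      rw [hV0]
      infer_instance
    · exact ContinuousLinearMap.finite_dimensional_eigenspace hT μ hμ
  -- All complex `μ` are allowed: a trivial eigenspace contributes the empty type `Fin 0`.
  let ι := Σ μ : ℂ, Fin (Module.finrank ℂ (V μ))
  let v : ι → G := fun i => (stdOrthonormalBasis ℂ (V i.1) i.2 : G)
  have hv : Orthonormal ℂ v :=
    (hT'.orthogonalFamily_eigenspaces).orthonormal_sigma_orthonormal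
      (v_family := fun μ => stdOrthonormalBasis ℂ (V μ)) fun μ => (stdOrthonormalBasis ℂ (V μ)).orthonormal
  have hTv' : ∀ i, T (v i) = i.1 • v i := fun i =>
    Module.End.mem_eigenspace_iff.1 (stdOrthonormalBasis ℂ (V i.1) i.2).2
  have hin : ∀ i, ⟪v i, T (v i)⟫_ℂ = i.1 := fun i => by
    rw [hTv', inner_smul_right, inner_self_eq_norm_sq_to_K, hv.1]
    simp
  have hre : ∀ i : ι, ((i.1.re : ℝ) : ℂ) = i.1 := fun i => by
    rw [← Complex.conj_eq_iff_re, ← hin, inner_conj_symm]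
    exact hT' _ _
  have hν : ∀ i : ι, 0 < i.1.re := fun i => by
    rw [← hin]
    exact hpos _ fun h => by simpa [h] using hv.1 i
  have hTv : ∀ i : ι, T (v i) = ((i.1.re : ℝ) : ℂ) • v i := fun i => by rw [hre, hTv']
  have hspan : (Submodule.span ℂ (Set.range v)).topologicalClosure = ⊤ := by
    rw [Submodule.topologicalClosure_eq_top_iff, eq_bot_iff,
      ← ContinuousLinearMap.orthogonalComplement_iSup_eigenspaces_eq_bot hT hT']
    refine Submodule.orthogonal_le (iSup_le fun μ x hx => ?_)
    have hx' : (⟨x, hx⟩ : V μ) ∈ Submodule.span ℂ (Set.range (stdOrthonormalBasis ℂ (V μ))) := by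
      rw [← OrthonormalBasis.coe_toBasis, Module.Basis.span_eq]
      trivial
    have hx2 := Submodule.mem_map_of_mem (f := (V μ).subtype) hx'
    rw [Submodule.map_span, ← Set.range_comp] at hx2
    refine Submodule.span_mono ?_ hx2
    rintro _ ⟨j, rfl⟩
    exact ⟨⟨μ, j⟩, rfl⟩
  have hinf : Infinite ι := by
    rw [← not_finite_iff_infinite]
    intro hfi
    apply hG
    have : FiniteDimensional ℂ (Submodule.span ℂ (Set.range v)) :=
      FiniteDimensional.span_of_finite ℂ (Set.finite_range v)
    rw [(Submodule.closed_of_finiteDimensional _).submodule_topologicalClosure_eq] at hspan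
    rw [hspan] at this
    exact (Submodule.topEquiv (R := ℂ) (M := G)).finiteDimensional
  have hlev : ∀ c : ℝ, {i : ι | i.1.re⁻¹ ≤ c}.Finite := fun c => by
    refine (finite_setOf_le_eigenvalue hT hv hTv (ε := (max c 1)⁻¹) (by positivity)).subset
      fun i hi => ?_
    exact inv_le_of_inv_le₀ (hν i) (le_trans hi (le_max_left _ _))
  obtain ⟨σ, hσ⟩ := exists_equiv_nat_monotone (fun i : ι => i.1.re⁻¹) hlev
  refine ⟨fun n => (σ n).1.re⁻¹, v ∘ σ, hσ, ?_, fun n => ?_, hv.comp _ σ.injective, ?_⟩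
  · refine tendsto_atTop_atTop_of_monotone hσ fun c => ?_
    by_contra! hcon
    refine Set.infinite_univ ((hlev c).preimage σ.injective.injOn |>.subset fun n _ => ?_)
    exact (hcon n).le
  · have := (hν (σ n)).ne'
    simp only [Function.comp_apply]
    rw [hTv, smul_smul, ← Complex.ofReal_mul, inv_mul_cancel₀ this]
    simp
  · rw [Set.range_comp, σ.range_eq_univ, Set.image_univ, hspan]

/-- A compact operator with dense range from a Hilbert space maps a suitable sequence of vectors,
orthogonal in the domain, to an orthonormal basis. -/
theorem exists_singularBasis [CompleteSpace G] {K : Type*} [NormedAddCommGroup K]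
    [InnerProductSpace ℂ K] [CompleteSpace K] (hG : ¬ FiniteDimensional ℂ G) {A : K →L[ℂ] G}
    (hA : IsCompactOperator A) (hdense : ∀ u : G, (∀ w, ⟪A w, u⟫_ℂ = 0) → u = 0) :
    ∃ (κ : ℕ → ℝ) (e : ℕ → K), Monotone κ ∧ Tendsto κ atTop atTop ∧
      (∀ n φ, ⟪φ, e n⟫_ℂ = κ n * ⟪A φ, A (e n)⟫_ℂ) ∧ Orthonormal ℂ (fun n => A (e n)) ∧
      (Submodule.span ℂ (Set.range fun n => A (e n))).topologicalClosure = ⊤ := by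
  have hTi : ∀ x y, ⟪x, (A ∘L A.adjoint) y⟫_ℂ = ⟪A.adjoint x, A.adjoint y⟫_ℂ := fun x y =>
    (A.adjoint_inner_left (A.adjoint y) x).symm
  have hsymm : ((A ∘L A.adjoint : G →L[ℂ] G) : G →ₗ[ℂ] G).IsSymmetric := fun x y => by
    change ⟪(A ∘L A.adjoint) x, y⟫_ℂ = ⟪x, (A ∘L A.adjoint) y⟫_ℂ
    rw [← inner_conj_symm, hTi, inner_conj_symm, hTi]
  -- Dense range of `A` means that the adjoint is injective.
  have hpos : ∀ x, x ≠ 0 → 0 < (⟪x, (A ∘L A.adjoint) x⟫_ℂ).re := fun x hx => by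
    rw [hTi]
    have h0 : A.adjoint x ≠ 0 := fun h0 => hx <| hdense x fun w => by
      rw [← A.adjoint_inner_right, h0, inner_zero_right]
    have h1 := inner_self_eq_norm_sq (𝕜 := ℂ) (A.adjoint x)
    rw [RCLike.re_eq_complex_re] at h1
    rw [h1]
    exact pow_pos (norm_pos_iff.2 h0) 2
  obtain ⟨κ, e, hmono, htop, he, hon, hspan⟩ :=
    exists_eigenbasis hG (hA.comp_clm A.adjoint : IsCompactOperator (A ∘L A.adjoint)) hsymm hpos
  have hE : ∀ n, A ((κ n : ℂ) • A.adjoint (e n)) = e n := fun n => by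
    rw [map_smul]
    exact he n
  -- Since κ A A* e = e, the vector κ A* e is a preimage of e under `A`.
  refine ⟨κ, fun n => (κ n : ℂ) • A.adjoint (e n), hmono, htop, fun n φ => ?_, ?_, ?_⟩
  · rw [hE, inner_smul_right, A.adjoint_inner_right]
  · simpa only [hE] using hon
  · simpa only [hE] using hspan

/-- A variant of `exists_singularBasis` for the restriction of a compact operator to a complete
subspace of an inner product space. -/
theorem exists_singularBasis_of_subspace [CompleteSpace G] {X : Type*} [NormedAddCommGroup X]
    [InnerProductSpace ℂ X] (H : Submodule ℂ X) [CompleteSpace H] (hG : ¬ FiniteDimensional ℂ G)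
    {A : X →L[ℂ] G} (hA : IsCompactOperator A)
    (hdense : ∀ u : G, (∀ w ∈ H, ⟪A w, u⟫_ℂ = 0) → u = 0) :
    ∃ (κ : ℕ → ℝ) (e : ℕ → X), Monotone κ ∧ Tendsto κ atTop atTop ∧
      (∀ n, e n ∈ H ∧ ∀ φ ∈ H, ⟪φ, e n⟫_ℂ = κ n * ⟪A φ, A (e n)⟫_ℂ) ∧
      Orthonormal ℂ (fun n => A (e n)) ∧
      (Submodule.span ℂ (Set.range fun n => A (e n))).topologicalClosure = ⊤ := by
  obtain ⟨κ, e, hmono, htop, he, hon, hspan⟩ :=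
    exists_singularBasis (A := A ∘L H.subtypeL) hG (hA.comp_clm H.subtypeL)
      fun u hu => hdense u fun w hw => hu ⟨w, hw⟩
  exact ⟨κ, fun n => e n, hmono, htop, fun n => ⟨(e n).2, fun φ hφ => he n ⟨φ, hφ⟩⟩, hon, hspan⟩

end

/-! ### Integration by parts and the Poincaré inequality for smooth functions. -/

section Calculus

open scoped ContDiff

variable {d n : ℕ} {f g : EuclideanSpace ℝ (Fin d) → ℂ}

lemma partialDeriv_zero (J : Fin 0 → Fin d) (f : EuclideanSpace ℝ (Fin d) → ℂ) :
    partialDeriv J f = f := by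
  ext x
  simp [partialDeriv]

lemma partialDeriv_succ (J : Fin (n + 1) → Fin d) (hf : ContDiff ℝ ∞ f) :
    partialDeriv J f = fun x => fderiv ℝ (partialDeriv (Fin.tail J) f) x
      (EuclideanSpace.single (J 0) (1 : ℝ)) := by
  ext x
  have h : DifferentiableAt ℝ (iteratedFDeriv ℝ n f) x :=
    (hf.differentiable_iteratedFDeriv (by exact_mod_cast ENat.natCast_lt_top n)).differentiableAt
  exact h.iteratedFDeriv_succ_apply_left'

lemma contDiff_lineDeriv (hf : ContDiff ℝ ∞ f) (v : EuclideanSpace ℝ (Fin d)) :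
    ContDiff ℝ ∞ fun x => fderiv ℝ f x v :=
  (hf.fderiv_right (m := ∞) (by simp)).clm_apply contDiff_const

lemma contDiff_partialDeriv (J : Fin n → Fin d) (hf : ContDiff ℝ ∞ f) :
    ContDiff ℝ ∞ (partialDeriv J f) := by
  induction n with
  | zero => rwa [partialDeriv_zero]
  | succ n ih =>
    rw [partialDeriv_succ J hf]
    exact contDiff_lineDeriv (ih _) _

lemma tsupport_partialDeriv_subset (J : Fin n → Fin d) (f : EuclideanSpace ℝ (Fin d) → ℂ) :
    tsupport (partialDeriv J f) ⊆ tsupport f := by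
  refine subset_trans (closure_mono ?_) (tsupport_iteratedFDeriv_subset (𝕜 := ℝ) n)
  intro x hx h
  exact hx (by simp [partialDeriv, h])

lemma hasCompactSupport_partialDeriv' (J : Fin n → Fin d) (hf : HasCompactSupport f) :
    HasCompactSupport (partialDeriv J f) :=
  hf.mono' (subset_trans (subset_tsupport _) (tsupport_partialDeriv_subset J f))

lemma fderiv_fderiv_comm (hf : ContDiff ℝ ∞ f) (x v w : EuclideanSpace ℝ (Fin d)) :
    fderiv ℝ (fun y => fderiv ℝ f y v) x w = fderiv ℝ (fun y => fderiv ℝ f y w) x v := by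
  have hd : DifferentiableAt ℝ (fderiv ℝ f) x :=
    ((hf.fderiv_right (m := ∞) (by simp)).differentiable (by simp)).differentiableAt
  have hs : IsSymmSndFDerivAt ℝ f x :=
    hf.contDiffAt.isSymmSndFDerivAt (by
      simp only [minSmoothness_of_isRCLikeNormedField]
      exact WithTop.coe_le_coe.2 le_top)
  rw [fderiv_clm_apply hd (differentiableAt_const _), fderiv_clm_apply hd (differentiableAt_const _)]
  simpa using hs w v

/-- Integration by parts moves the outermost derivative of `g` onto `f` first, where it becomes the
innermost one; this commutation restores the order. -/
lemma partialDeriv_lineDeriv (J : Fin n → Fin d) (hf : ContDiff ℝ ∞ f)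
    (v : EuclideanSpace ℝ (Fin d)) :
    partialDeriv J (fun y => fderiv ℝ f y v) = fun x => fderiv ℝ (partialDeriv J f) x v := by
  induction n with
  | zero => simp [partialDeriv_zero]
  | succ n ih =>
    rw [partialDeriv_succ J (contDiff_lineDeriv hf v), partialDeriv_succ J hf, ih]
    ext x
    exact fderiv_fderiv_comm (contDiff_partialDeriv _ hf) _ _ _

theorem integral_mul_partialDeriv (J : Fin n → Fin d) (hf : ContDiff ℝ ∞ f) (hg : ContDiff ℝ ∞ g)
    (hc : HasCompactSupport g) :
    ∫ x, f x * partialDeriv J g x = (-1) ^ n * ∫ x, partialDeriv J f x * g x := by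
  induction n generalizing f with
  | zero => simp [partialDeriv_zero]
  | succ n ih =>
    have hp := contDiff_partialDeriv (Fin.tail J) hg
    have hpc := hasCompactSupport_partialDeriv' (Fin.tail J) hc
    have hd := contDiff_lineDeriv hf (EuclideanSpace.single (J 0) (1 : ℝ))
    have hd' := contDiff_lineDeriv hp (EuclideanSpace.single (J 0) (1 : ℝ))
    have hdc : HasCompactSupport fun x => fderiv ℝ (partialDeriv (Fin.tail J) g) x
        (EuclideanSpace.single (J 0) (1 : ℝ)) := by
      rw [← partialDeriv_succ J hg]
      exact hasCompactSupport_partialDeriv' J hc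
    rw [partialDeriv_succ J hg, integral_mul_fderiv_eq_neg_fderiv_mul_of_integrable
      ((hd.continuous.mul hp.continuous).integrable_of_hasCompactSupport hpc.mul_left)
      ((hf.continuous.mul hd'.continuous).integrable_of_hasCompactSupport hdc.mul_left)
      ((hf.continuous.mul hp.continuous).integrable_of_hasCompactSupport hpc.mul_left)
      (fun x _ => hf.differentiable (by simp) x) (fun x _ => hp.differentiable (by simp) x),
      ih _ hd, partialDeriv_lineDeriv _ hf, partialDeriv_succ J hf, pow_succ]
    ring

lemma partialDeriv_conj (J : Fin n → Fin d) (hf : ContDiff ℝ ∞ f)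
    (x : EuclideanSpace ℝ (Fin d)) :
    partialDeriv J (fun y => (starRingEnd ℂ) (f y)) x = (starRingEnd ℂ) (partialDeriv J f x) := by
  have h := (Complex.conjCLE : ℂ →L[ℝ] ℂ).iteratedFDeriv_comp_left (i := n)
    (hf.contDiffAt (x := x)) (by exact_mod_cast le_top)
  have h2 := congrArg (fun L => L fun i => EuclideanSpace.single (J i) (1 : ℝ)) h
  exact h2

lemma fderiv_norm_sq_apply (hf : ContDiff ℝ ∞ f) (x v : EuclideanSpace ℝ (Fin d)) :
    fderiv ℝ (fun x => ‖f x‖ ^ 2) x v = 2 * ⟪f x, fderiv ℝ f x v⟫_ℝ := by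
  rw [((hf.differentiable (by simp) x).hasFDerivAt.norm_sq).fderiv, two_smul, two_mul]
  rfl

lemma fderiv_coord_apply (x v : EuclideanSpace ℝ (Fin d)) (j : Fin d) :
    fderiv ℝ (fun x : EuclideanSpace ℝ (Fin d) => x j) x v = v j := by
  have : (fun x : EuclideanSpace ℝ (Fin d) => x j) = EuclideanSpace.proj (𝕜 := ℝ) j := rfl
  rw [this, ContinuousLinearMap.fderiv]
  rfl

/-- Young's inequality, weighted so that the term in `a` has coefficient 1/2 and can be absorbed in
the Poincaré inequality. -/
lemma neg_mul_inner_le {R t : ℝ} {a b : ℂ} (ht : |t| ≤ R) :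
    -(t * (2 * ⟪a, b⟫_ℝ)) ≤ 1 / 2 * ‖a‖ ^ 2 + 2 * R ^ 2 * ‖b‖ ^ 2 := by
  have h2 := abs_real_inner_le_norm a b
  have h3 : |t * ⟪a, b⟫_ℝ| ≤ R * (‖a‖ * ‖b‖) := by
    rw [abs_mul]
    exact mul_le_mul ht h2 (abs_nonneg _) ((abs_nonneg _).trans ht)
  have h4 := neg_le_of_abs_le h3
  nlinarith [sq_nonneg (‖a‖ - 2 * R * ‖b‖)]

/-- The **Poincaré inequality** for one partial derivative. -/
theorem integral_norm_sq_le_fderiv {R : ℝ} (hf : ContDiff ℝ ∞ f) (hc : HasCompactSupport f)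
    (hR : ∀ x ∈ tsupport f, ‖x‖ ≤ R) {v : EuclideanSpace ℝ (Fin d)} {j : Fin d} (hv : v j = 1) :
    ∫ x, ‖f x‖ ^ 2 ≤ 4 * R ^ 2 * ∫ x, ‖fderiv ℝ f x v‖ ^ 2 := by
  have hdf := contDiff_lineDeriv hf v
  have hg : ContDiff ℝ ∞ fun x => ‖f x‖ ^ 2 := hf.norm_sq ℝ
  have hgc : HasCompactSupport fun x => ‖f x‖ ^ 2 :=
    hc.comp_left (g := fun z : ℂ => ‖z‖ ^ 2) (by simp)
  have hdc : HasCompactSupport fun x => fderiv ℝ f x v := hc.fderiv_apply ℝ v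
  have hx : ContDiff ℝ ∞ fun x : EuclideanSpace ℝ (Fin d) => x j := by fun_prop
  have hgc' : HasCompactSupport fun x => fderiv ℝ (fun x => ‖f x‖ ^ 2) x v := hgc.fderiv_apply ℝ v
  have hgd : Continuous fun x => fderiv ℝ (fun x => ‖f x‖ ^ 2) x v := by
    simp only [fderiv_norm_sq_apply hf]
    exact continuous_const.mul (hf.continuous.inner hdf.continuous)
  have hxd : Integrable fun x : EuclideanSpace ℝ (Fin d) =>
      x j * fderiv ℝ (fun x => ‖f x‖ ^ 2) x v :=
    (hx.continuous.mul hgd).integrable_of_hasCompactSupport hgc'.mul_left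
  have hgi : Integrable fun x => ‖f x‖ ^ 2 := hg.continuous.integrable_of_hasCompactSupport hgc
  have hdc' : HasCompactSupport fun x => ‖fderiv ℝ f x v‖ ^ 2 :=
    hdc.comp_left (g := fun z : ℂ => ‖z‖ ^ 2) (by simp)
  have hdi : Integrable fun x => ‖fderiv ℝ f x v‖ ^ 2 :=
    Continuous.integrable_of_hasCompactSupport (by fun_prop) hdc'
  -- Integration by parts against the coordinate `x j`, whose derivative along `v` is `v j = 1`.
  have key : ∫ x : EuclideanSpace ℝ (Fin d), x j * fderiv ℝ (fun x => ‖f x‖ ^ 2) x v =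
      -∫ x, ‖f x‖ ^ 2 := by
    rw [integral_mul_fderiv_eq_neg_fderiv_mul_of_integrable
      (by simpa only [fderiv_coord_apply, hv, one_mul] using hgi) hxd
      ((hx.continuous.mul hg.continuous).integrable_of_hasCompactSupport hgc.mul_left)
      (fun x _ => hx.differentiable (by simp) x) (fun x _ => hg.differentiable (by simp) x)]
    simp only [fderiv_coord_apply, hv, one_mul]
  have hle : -∫ x : EuclideanSpace ℝ (Fin d), x j * fderiv ℝ (fun x => ‖f x‖ ^ 2) x v ≤
      ∫ x, (1 / 2 * ‖f x‖ ^ 2 + 2 * R ^ 2 * ‖fderiv ℝ f x v‖ ^ 2) := by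
    rw [← integral_neg]
    refine integral_mono hxd.neg ((hgi.const_mul _).add (hdi.const_mul _)) fun x => ?_
    simp only [fderiv_norm_sq_apply hf]
    by_cases hxs : x ∈ tsupport f
    · exact neg_mul_inner_le ((PiLp.norm_apply_le x j).trans (hR x hxs))
    · rw [image_eq_zero_of_notMem_tsupport hxs]
      simp only [inner_zero_left, mul_zero, neg_zero]
      positivity
  rw [integral_add (hgi.const_mul _) (hdi.const_mul _), integral_const_mul,
    integral_const_mul, key, neg_neg] at hle
  generalize ∫ x, ‖f x‖ ^ 2 = A at hle ⊢
  linarith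

/-- The Poincaré inequality for iterated partial derivatives. -/
theorem integral_norm_sq_partialDeriv_le {R : ℝ} (hf : ContDiff ℝ ∞ f) (hc : HasCompactSupport f)
    (hR : ∀ x ∈ tsupport f, ‖x‖ ≤ R) {n m : ℕ} (hn : n ≤ m) (J : Fin n → Fin d) (hd : 0 < d) :
    ∃ J' : Fin m → Fin d, ∫ x, ‖partialDeriv J f x‖ ^ 2 ≤
      (4 * R ^ 2) ^ (m - n) * ∫ x, ‖partialDeriv J' f x‖ ^ 2 := by
  induction m, hn using Nat.le_induction with
  | base => exact ⟨J, by simp⟩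
  | succ m hm ih =>
    obtain ⟨J', hJ'⟩ := ih
    -- Any coordinate direction would do for the additional derivative.
    refine ⟨Fin.cons ⟨0, hd⟩ J', hJ'.trans ?_⟩
    rw [partialDeriv_succ _ hf, Nat.succ_sub hm, pow_succ (4 * R ^ 2), mul_assoc]
    refine mul_le_mul_of_nonneg_left ?_ (by positivity)
    exact integral_norm_sq_le_fderiv (contDiff_partialDeriv J' hf)
      (hasCompactSupport_partialDeriv' J' hc)
      (fun x hx => hR x (tsupport_partialDeriv_subset J' f hx)) (j := ⟨0, hd⟩) (by simp)

end Calculus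

/-! ### Weak derivatives, completeness and density of H^m_0. -/

section SobolevSpace

open scoped ContDiff

variable {d m n : ℕ} {Ω : Opens (EuclideanSpace ℝ (Fin d))} {f g : EuclideanSpace ℝ (Fin d) → ℂ}

/-- The complex conjugate of a test function. -/
noncomputable def conjTest (φ : 𝓓(Ω, ℂ)) : 𝓓(Ω, ℂ) :=
  ⟨fun x => (starRingEnd ℂ) (φ x), Complex.conjCLE.contDiff.comp φ.contDiff,
    φ.hasCompactSupport.comp_left (g := starRingEnd ℂ) (map_zero _),
    (closure_mono (Function.support_comp_subset (map_zero (starRingEnd ℂ)) φ)).trans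
      φ.tsupport_subset⟩

lemma conjTest_apply (φ : 𝓓(Ω, ℂ)) (x : EuclideanSpace ℝ (Fin d)) :
    conjTest φ x = (starRingEnd ℂ) (φ x) := rfl

lemma memLp_restrict (hb : Bornology.IsBounded (Ω : Set (EuclideanSpace ℝ (Fin d))))
    (hf : Continuous f) : MemLp f 2 (volume.restrict (Ω : Set (EuclideanSpace ℝ (Fin d)))) := by
  obtain ⟨R, hR⟩ := hb.subset_closedBall 0
  obtain ⟨C, hC⟩ := (isCompact_closedBall (0 : EuclideanSpace ℝ (Fin d)) R).exists_bound_of_continuousOn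
    hf.continuousOn
  have : IsFiniteMeasure (volume.restrict (Ω : Set (EuclideanSpace ℝ (Fin d)))) :=
    ⟨by simpa using hb.measure_lt_top⟩
  refine MemLp.of_bound hf.aestronglyMeasurable C ?_
  filter_upwards [ae_restrict_mem Ω.isOpen.measurableSet] with x hx using hC x (hR hx)

/-- The class in `L²(Ω)` of a continuous function on `ℝ^d`, for a bounded open set `Ω`. -/
noncomputable def restr (hb : Bornology.IsBounded (Ω : Set (EuclideanSpace ℝ (Fin d))))
    (hf : Continuous f) : L2 Ω :=
  (memLp_restrict hb hf).toLp f

lemma coeFn_restr (hb : Bornology.IsBounded (Ω : Set (EuclideanSpace ℝ (Fin d))))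
    (hf : Continuous f) :
    restr hb hf =ᵐ[volume.restrict (Ω : Set (EuclideanSpace ℝ (Fin d)))] f :=
  MemLp.coeFn_toLp _

lemma inner_restr (hb : Bornology.IsBounded (Ω : Set (EuclideanSpace ℝ (Fin d))))
    (hf : Continuous f) (u : L2 Ω) : ⟪restr hb hf, u⟫_ℂ =
      ∫ x in (Ω : Set (EuclideanSpace ℝ (Fin d))), u x * (starRingEnd ℂ) (f x) := by
  rw [L2.inner_def]
  refine integral_congr_ae ?_
  filter_upwards [coeFn_restr hb hf] with x hx
  rw [hx]
  rfl

lemma integral_mul_eq_inner (hb : Bornology.IsBounded (Ω : Set (EuclideanSpace ℝ (Fin d))))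
    (hf : Continuous f) (u : L2 Ω) :
    ∫ x in (Ω : Set (EuclideanSpace ℝ (Fin d))), u x * f x =
      ⟪restr hb (f := fun x => (starRingEnd ℂ) (f x)) (Complex.continuous_conj.comp hf), u⟫_ℂ := by
  rw [inner_restr]
  simp

lemma norm_restr_sq (hb : Bornology.IsBounded (Ω : Set (EuclideanSpace ℝ (Fin d))))
    (hf : Continuous f) :
    ‖restr hb hf‖ ^ 2 = ∫ x in (Ω : Set (EuclideanSpace ℝ (Fin d))), ‖f x‖ ^ 2 := by
  have h : ((‖restr hb hf‖ ^ 2 : ℝ) : ℂ) =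
      ((∫ x in (Ω : Set (EuclideanSpace ℝ (Fin d))), ‖f x‖ ^ 2 : ℝ) : ℂ) := by
    rw [← integral_complex_ofReal]
    push_cast
    have h2 := inner_self_eq_norm_sq_to_K (𝕜 := ℂ) (restr hb hf)
    rw [inner_restr] at h2
    refine h2.symm.trans (integral_congr_ae ?_)
    filter_upwards [coeFn_restr hb hf] with x hx
    rw [hx, Complex.mul_conj']
  exact_mod_cast h

lemma setIntegral_mul_right_eq (hg : tsupport g ⊆ Ω) :
    ∫ x in (Ω : Set (EuclideanSpace ℝ (Fin d))), f x * g x = ∫ x, f x * g x :=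
  setIntegral_eq_integral_of_forall_compl_eq_zero fun x hx => by
    rw [image_eq_zero_of_notMem_tsupport fun h => hx (hg h), mul_zero]

lemma setIntegral_partialDeriv (J : Fin n → Fin d) (hf : ContDiff ℝ ∞ f) (φ : 𝓓(Ω, ℂ)) :
    ∫ x in (Ω : Set (EuclideanSpace ℝ (Fin d))), f x * partialDeriv J φ x =
      (-1) ^ n * ∫ x in (Ω : Set (EuclideanSpace ℝ (Fin d))), partialDeriv J f x * φ x := by
  rw [setIntegral_mul_right_eq ((tsupport_partialDeriv_subset J φ).trans φ.tsupport_subset),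
    setIntegral_mul_right_eq φ.tsupport_subset]
  exact integral_mul_partialDeriv J hf φ.contDiff φ.hasCompactSupport

lemma hasWeakDeriv_restr (hb : Bornology.IsBounded (Ω : Set (EuclideanSpace ℝ (Fin d))))
    (J : Fin n → Fin d) (hf : ContDiff ℝ ∞ f) :
    HasWeakDeriv J (restr hb hf.continuous) (restr hb (contDiff_partialDeriv J hf).continuous) := by
  intro φ
  have h1 : ∫ x in (Ω : Set (EuclideanSpace ℝ (Fin d))),
      restr hb hf.continuous x * partialDeriv J φ x =
      ∫ x in (Ω : Set (EuclideanSpace ℝ (Fin d))), f x * partialDeriv J φ x := by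
    refine integral_congr_ae ?_
    filter_upwards [coeFn_restr hb hf.continuous] with x hx
    rw [hx]
  have h2 : ∫ x in (Ω : Set (EuclideanSpace ℝ (Fin d))),
      restr hb (contDiff_partialDeriv J hf).continuous x * φ x =
      ∫ x in (Ω : Set (EuclideanSpace ℝ (Fin d))), partialDeriv J f x * φ x := by
    refine integral_congr_ae ?_
    filter_upwards [coeFn_restr hb (contDiff_partialDeriv J hf).continuous] with x hx
    rw [hx]
  rw [h1, h2, setIntegral_partialDeriv J hf φ]

/-- The element of `H^m(Ω)` given by a smooth function on `ℝ^d`, for a bounded open set `Ω`. -/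
noncomputable def ofSmooth (hb : Bornology.IsBounded (Ω : Set (EuclideanSpace ℝ (Fin d)))) (m : ℕ)
    (hf : ContDiff ℝ ∞ f) : Sobolev Ω m :=
  ⟨WithLp.toLp 2 (restr hb hf.continuous,
    WithLp.toLp 2 fun J => restr hb (contDiff_partialDeriv J hf).continuous),
    fun J => hasWeakDeriv_restr hb J hf, fun _ _ J => ⟨_, hasWeakDeriv_restr hb J hf⟩⟩

lemma toL2_ofSmooth (hb : Bornology.IsBounded (Ω : Set (EuclideanSpace ℝ (Fin d))))
    (hf : ContDiff ℝ ∞ f) : toL2 Ω m (ofSmooth hb m hf) = restr hb hf.continuous := rfl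

lemma topDeriv_ofSmooth (hb : Bornology.IsBounded (Ω : Set (EuclideanSpace ℝ (Fin d))))
    (hf : ContDiff ℝ ∞ f) (J : Fin m → Fin d) :
    topDeriv Ω m (ofSmooth hb m hf) J = restr hb (contDiff_partialDeriv J hf).continuous := rfl

lemma inner_sobolev (u v : Sobolev Ω m) :
    ⟪u, v⟫_ℂ = ⟪toL2 Ω m u, toL2 Ω m v⟫_ℂ + ⟪topDeriv Ω m u, topDeriv Ω m v⟫_ℂ := by
  rw [Submodule.coe_inner, WithLp.prod_inner_apply]
  rfl

lemma norm_toL2_le (u : Sobolev Ω m) : ‖toL2 Ω m u‖ ≤ ‖u‖ :=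
  WithLp.norm_fst_le _ u.1

lemma norm_topDeriv_le (u : Sobolev Ω m) : ‖topDeriv Ω m u‖ ≤ ‖u‖ :=
  WithLp.norm_snd_le _ u.1

lemma continuous_toL2 : Continuous (toL2 Ω m) :=
  (LinearMap.mkContinuous (toL2 Ω m) 1 fun u => by simpa using norm_toL2_le u).continuous

lemma continuous_topDeriv : Continuous (topDeriv Ω m) :=
  (LinearMap.mkContinuous (topDeriv Ω m) 1 fun u => by simpa using norm_topDeriv_le u).continuous

theorem eq_zero_of_forall_testFunction
    (hb : Bornology.IsBounded (Ω : Set (EuclideanSpace ℝ (Fin d)))) {u : L2 Ω}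
    (h : ∀ φ : 𝓓(Ω, ℂ), ∫ x in (Ω : Set (EuclideanSpace ℝ (Fin d))), u x * φ x = 0) : u = 0 := by
  have : IsFiniteMeasure (volume.restrict (Ω : Set (EuclideanSpace ℝ (Fin d)))) :=
    ⟨by simpa using hb.measure_lt_top⟩
  have hu : Integrable u (volume.restrict (Ω : Set (EuclideanSpace ℝ (Fin d)))) :=
    (Lp.memLp u).integrable (by norm_num)
  have key := Ω.isOpen.ae_eq_zero_of_integral_contDiff_smul_eq_zero (μ := volume) (f := u)
    (IntegrableOn.locallyIntegrableOn hu) fun g hg hgc hgs => by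
      let φ : 𝓓(Ω, ℂ) := ⟨fun x => (g x : ℂ), Complex.ofRealCLM.contDiff.comp hg,
        hgc.comp_left (g := ((↑) : ℝ → ℂ)) rfl,
        (closure_mono (Function.support_comp_subset Complex.ofReal_zero g)).trans hgs⟩
      rw [← setIntegral_eq_integral_of_forall_compl_eq_zero
        (s := (Ω : Set (EuclideanSpace ℝ (Fin d)))) fun x hx => by
          rw [image_eq_zero_of_notMem_tsupport fun h => hx (hgs h), zero_smul]]
      rw [← h φ]
      refine integral_congr_ae (Eventually.of_forall fun x => ?_)
      exact (Complex.real_smul).trans (mul_comm _ _)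
  rw [Lp.eq_zero_iff_ae_eq_zero]
  filter_upwards [(ae_restrict_iff' Ω.isOpen.measurableSet).2 key] with x hx using hx

lemma HasWeakDeriv.unique (hb : Bornology.IsBounded (Ω : Set (EuclideanSpace ℝ (Fin d))))
    {J : Fin n → Fin d} {u v v' : L2 Ω} (h : HasWeakDeriv J u v) (h' : HasWeakDeriv J u v') :
    v = v' := by
  rw [← sub_eq_zero]
  have h0 := h.add (h'.smul (-1))
  rw [neg_one_smul, neg_one_smul, add_neg_cancel, ← sub_eq_add_neg] at h0
  refine eq_zero_of_forall_testFunction hb fun φ => ?_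
  have h1 := h0 φ
  have h2 := (HasWeakDeriv.zero (J := J) (Ω := Ω)) φ
  rw [h2] at h1
  have h3 : ∫ x in (Ω : Set (EuclideanSpace ℝ (Fin d))), (0 : L2 Ω) x * φ x = 0 := by
    rw [integral_mul_eq_inner hb φ.continuous, inner_zero_right]
  rw [h3, mul_zero] at h1
  simpa using h1.symm

lemma HasWeakDeriv.of_tendsto (hb : Bornology.IsBounded (Ω : Set (EuclideanSpace ℝ (Fin d))))
    {J : Fin n → Fin d} {u v : ℕ → L2 Ω} {u' v' : L2 Ω} (h : ∀ k, HasWeakDeriv J (u k) (v k))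
    (hu : Tendsto u atTop (nhds u')) (hv : Tendsto v atTop (nhds v')) : HasWeakDeriv J u' v' := by
  intro φ
  have h' := fun k => h k φ
  simp only [integral_mul_eq_inner hb φ.continuous,
    integral_mul_eq_inner hb (continuous_partialDeriv J φ)] at h' ⊢
  refine tendsto_nhds_unique (tendsto_const_nhds.inner hu) ?_
  simp only [h']
  exact (tendsto_const_nhds.inner hv).const_mul _

/-- Membership in `testSubspace` prescribes only the function; uniqueness of weak derivatives
identifies the rest of the jet. -/
lemma exists_eq_ofSmooth (hb : Bornology.IsBounded (Ω : Set (EuclideanSpace ℝ (Fin d))))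
    {w : Sobolev Ω m} (hw : w ∈ testSubspace Ω m) :
    ∃ φ : 𝓓(Ω, ℂ), w = ofSmooth hb m φ.contDiff := by
  obtain ⟨φ, hφ⟩ := hw
  have h1 : w.1.fst = restr hb φ.continuous :=
    Lp.ext (hφ.trans (coeFn_restr hb φ.continuous).symm)
  refine ⟨φ, Subtype.ext (WithLp.ofLp_injective 2 (Prod.ext h1 (PiLp.ext fun J => ?_)))⟩
  have h2 := w.2.1 J
  rw [h1] at h2
  exact h2.unique hb (hasWeakDeriv_restr hb J φ.contDiff)

lemma ofSmooth_mem_testSubspace (hb : Bornology.IsBounded (Ω : Set (EuclideanSpace ℝ (Fin d))))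
    (φ : 𝓓(Ω, ℂ)) : ofSmooth hb m φ.contDiff ∈ testSubspace Ω m :=
  ⟨φ, coeFn_restr hb φ.continuous⟩

/-- On test functions the top order derivatives control the lower order ones. -/
theorem exists_norm_weakDeriv_le (hd : 0 < d)
    (hb : Bornology.IsBounded (Ω : Set (EuclideanSpace ℝ (Fin d)))) {n : ℕ} (hn : n ≤ m) :
    ∃ C : ℝ, ∀ w ∈ testSubspace Ω m, ∀ (J : Fin n → Fin d) (v : L2 Ω),
      HasWeakDeriv J (toL2 Ω m w) v → ‖v‖ ≤ C * ‖topDeriv Ω m w‖ := by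
  obtain ⟨R, hR⟩ := hb.subset_closedBall 0
  refine ⟨√((4 * R ^ 2) ^ (m - n)), fun w hw J v hv => ?_⟩
  obtain ⟨φ, rfl⟩ := exists_eq_ofSmooth hb hw
  obtain rfl := hv.unique hb (hasWeakDeriv_restr hb J φ.contDiff)
  obtain ⟨J', hJ'⟩ := integral_norm_sq_partialDeriv_le φ.contDiff φ.hasCompactSupport
    (fun x hx => by simpa using hR (φ.tsupport_subset hx)) hn J hd
  have hset : ∀ {k : ℕ} (I : Fin k → Fin d),
      ‖restr hb (contDiff_partialDeriv I φ.contDiff).continuous‖ ^ 2 =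
      ∫ x, ‖partialDeriv I φ x‖ ^ 2 := fun I => by
    rw [norm_restr_sq]
    refine setIntegral_eq_integral_of_forall_compl_eq_zero fun x hx => ?_
    rw [image_eq_zero_of_notMem_tsupport fun h =>
      hx (φ.tsupport_subset (tsupport_partialDeriv_subset I φ h))]
    simp
  rw [← hset, ← hset, ← topDeriv_ofSmooth hb φ.contDiff J'] at hJ'
  have h2 := PiLp.norm_apply_le (topDeriv Ω m (ofSmooth hb m φ.contDiff)) J'
  refine le_of_sq_le_sq ?_ (by positivity)
  rw [mul_pow, Real.sq_sqrt (by positivity)]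
  exact hJ'.trans (mul_le_mul_of_nonneg_left (pow_le_pow_left₀ (norm_nonneg _) h2 2) (by positivity))

/-- The norm of `Jet` sees only orders 0 and m. For test functions the Poincaré inequality makes the
intermediate derivatives Cauchy as well, so the limit has them too, whatever the regularity of the
boundary. -/
theorem closure_testSubspace_subset (hd : 0 < d)
    (hb : Bornology.IsBounded (Ω : Set (EuclideanSpace ℝ (Fin d)))) :
    closure ((↑) '' (testSubspace Ω m : Set (Sobolev Ω m)) : Set (Jet Ω m)) ⊆ Sobolev Ω m := by
  intro w hw
  obtain ⟨s, hs, hlim⟩ := mem_closure_iff_seq_limit.1 hw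
  choose t ht hts using hs
  obtain rfl : (fun k => (t k : Jet Ω m)) = s := funext hts
  have hfst : Tendsto (fun k => toL2 Ω m (t k)) atTop (nhds w.fst) :=
    ((WithLp.prod_continuous_ofLp 2 _ _).fst.tendsto w).comp hlim
  refine ⟨fun J => ?_, fun n hn J => ?_⟩
  · refine HasWeakDeriv.of_tendsto hb (fun k => (t k).2.1 J) hfst ?_
    have h1 : Continuous fun w : Jet Ω m => w.snd J :=
      (PiLp.continuous_apply 2 _ J).comp (WithLp.prod_continuous_ofLp 2 _ _).snd
    exact (h1.tendsto w).comp hlim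
  · choose v hv using fun k => (t k).2.2 n hn J
    obtain ⟨C, hC⟩ := exists_norm_weakDeriv_le (m := m) hd hb hn
    have hcau : CauchySeq v := by
      have hct : CauchySeq t := by
        have h1 := Metric.cauchySeq_iff.1 hlim.cauchySeq
        exact Metric.cauchySeq_iff.2 h1
      have hle : ∀ k l, dist (v k) (v l) ≤ |C| * dist (t k) (t l) := fun k l => by
        rw [dist_eq_norm, dist_eq_norm]
        have h1 := (hv k).add ((hv l).smul (-1))
        rw [neg_one_smul, neg_one_smul, ← sub_eq_add_neg, ← sub_eq_add_neg] at h1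
        refine (hC (t k - t l) (Submodule.sub_mem _ (ht k) (ht l)) J _ h1).trans ?_
        exact mul_le_mul (le_abs_self C) (norm_topDeriv_le _) (norm_nonneg _) (abs_nonneg _)
      rw [Metric.cauchySeq_iff] at hct ⊢
      intro ε hε
      obtain ⟨N, hN⟩ := hct (ε / (|C| + 1)) (by positivity)
      refine ⟨N, fun k hk l hl => ?_⟩
      have h1 := hN k hk l hl
      rw [lt_div_iff₀ (by positivity)] at h1
      nlinarith [hle k l, dist_nonneg (x := t k) (y := t l), abs_nonneg C]
    obtain ⟨v', hv'⟩ := cauchySeq_tendsto_of_complete hcau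
    exact ⟨v', HasWeakDeriv.of_tendsto hb hv hfst hv'⟩

/-- By the previous inclusion, closing the test functions in H^m or in the complete space `Jet`
gives the same set. -/
theorem completeSpace_sobolev0 (hd : 0 < d)
    (hb : Bornology.IsBounded (Ω : Set (EuclideanSpace ℝ (Fin d)))) :
    CompleteSpace (Sobolev0 Ω m) := by
  have h : ((↑) '' (Sobolev0 Ω m : Set (Sobolev Ω m)) : Set (Jet Ω m)) =
      closure ((↑) '' (testSubspace Ω m : Set (Sobolev Ω m))) := by
    rw [Sobolev0, Submodule.topologicalClosure_coe,
      Topology.IsInducing.subtypeVal.closure_eq_preimage_closure_image]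
    refine Set.Subset.antisymm (Set.image_preimage_subset _ _) fun w hw => ?_
    exact ⟨⟨w, closure_testSubspace_subset hd hb hw⟩, hw, rfl⟩
  have h2 : IsComplete ((↑) '' (Sobolev0 Ω m : Set (Sobolev Ω m)) : Set (Jet Ω m)) := by
    rw [h]
    exact isClosed_closure.isComplete
  exact completeSpace_coe_iff_isComplete.2 <|
    (isUniformEmbedding_subtype_val.isUniformInducing.isComplete_iff).1 h2

/-- The **Poincaré inequality** on `H^m_0(Ω)`. -/
theorem exists_norm_toL2_le (hd : 0 < d)
    (hb : Bornology.IsBounded (Ω : Set (EuclideanSpace ℝ (Fin d)))) :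
    ∃ C : ℝ, ∀ w ∈ Sobolev0 Ω m, ‖toL2 Ω m w‖ ≤ C * ‖topDeriv Ω m w‖ := by
  obtain ⟨C, hC⟩ := exists_norm_weakDeriv_le (m := m) hd hb (Nat.zero_le m)
  refine ⟨C, fun w hw => ?_⟩
  refine closure_minimal (s := (testSubspace Ω m : Set (Sobolev Ω m)))
    (t := {w | ‖toL2 Ω m w‖ ≤ C * ‖topDeriv Ω m w‖}) (fun w hw => ?_)
    (isClosed_le continuous_toL2.norm (continuous_const.mul continuous_topDeriv.norm)) hw
  -- A function is its own weak derivative of order 0.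
  refine hC w hw Fin.elim0 _ fun φ => ?_
  simp [partialDeriv_zero]

theorem dense_sobolev0 (hb : Bornology.IsBounded (Ω : Set (EuclideanSpace ℝ (Fin d))))
    {u : L2 Ω} (hu : ∀ w ∈ Sobolev0 Ω m, ⟪toL2 Ω m w, u⟫_ℂ = 0) : u = 0 := by
  refine eq_zero_of_forall_testFunction hb fun φ => ?_
  rw [integral_mul_eq_inner hb φ.continuous]
  exact hu (ofSmooth hb m (conjTest φ).contDiff)
    (Submodule.le_topologicalClosure _ (ofSmooth_mem_testSubspace hb (conjTest φ)))

end SobolevSpace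

/-! ### Existence of the eigenvalue sequences. -/

section Existence

variable {d m : ℕ} {Ω : Opens (EuclideanSpace ℝ (Fin d))}

/-- The variational eigenvalue problem on a complete subspace of `H^m(Ω)` that is dense in
`L²(Ω)` has a sequence of eigenvalues, if the embedding into `L²(Ω)` is compact. -/
theorem exists_isEigenvalueSequence (hcompact : IsCompactOperator (toL2 Ω m))
    (hinf : ¬ FiniteDimensional ℂ (L2 Ω)) (H : Submodule ℂ (Sobolev Ω m)) [CompleteSpace H]
    (hdense : ∀ u : L2 Ω, (∀ w ∈ H, ⟪toL2 Ω m w, u⟫_ℂ = 0) → u = 0) :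
    ∃ Λ : ℕ → ℝ, IsEigenvalueSequence H Λ := by
  let A : Sobolev Ω m →L[ℂ] L2 Ω := ⟨toL2 Ω m, continuous_toL2⟩
  obtain ⟨κ, e, hmono, htop, he, hon, hspan⟩ :=
    exists_singularBasis_of_subspace (X := Sobolev Ω m) H hinf (A := A) hcompact hdense
  -- The inner product of H^m contains the L² term, which shifts every eigenvalue by 1.
  refine ⟨fun n => κ n - 1, fun a b hab => sub_le_sub_right (hmono hab) 1,
    tendsto_atTop_add_const_right _ _ htop, e, fun n => ⟨(he n).1, fun φ hφ => ?_⟩, hon, hspan⟩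
  have h1 : ⟪φ, e n⟫_ℂ = κ n * ⟪toL2 Ω m φ, toL2 Ω m (e n)⟫_ℂ := (he n).2 φ hφ
  rw [inner_sobolev] at h1
  rw [eq_sub_of_add_eq' h1]
  push_cast
  ring

end Existence

/-! ### Exponentials: independence, integration by parts, Fourier uniqueness. -/

section Exponentials

open scoped ContDiff

variable {d m n : ℕ} {Ω : Opens (EuclideanSpace ℝ (Fin d))}

/-- The linear form `x ↦ ∑ j, ζ j * x j`. -/
noncomputable def linForm (ζ : Fin d → ℂ) : EuclideanSpace ℝ (Fin d) →L[ℝ] ℂ :=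
  ∑ j, (EuclideanSpace.proj (𝕜 := ℝ) j : EuclideanSpace ℝ (Fin d) →L[ℝ] ℝ).smulRight (ζ j)

lemma linForm_apply (ζ : Fin d → ℂ) (x : EuclideanSpace ℝ (Fin d)) :
    linForm ζ x = ∑ j, (x j : ℂ) * ζ j := by
  simp [linForm]

lemma linForm_single (ζ : Fin d → ℂ) (j : Fin d) :
    linForm ζ (EuclideanSpace.single j (1 : ℝ)) = ζ j := by
  rw [linForm_apply, Finset.sum_eq_single j]
  · simp
  · intro i _ hi
    simp [hi]
  · simp

/-- The exponential `x ↦ exp (∑ j, ζ j * x j)`. -/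
noncomputable def expo (ζ : Fin d → ℂ) (x : EuclideanSpace ℝ (Fin d)) : ℂ :=
  Complex.exp (linForm ζ x)

lemma contDiff_expo (ζ : Fin d → ℂ) : ContDiff ℝ ∞ (expo ζ) :=
  (linForm ζ).contDiff.cexp

lemma continuous_expo (ζ : Fin d → ℂ) : Continuous (expo ζ) := (contDiff_expo ζ).continuous

lemma analyticOnNhd_expo (ζ : Fin d → ℂ) : AnalyticOnNhd ℝ (expo ζ) Set.univ := fun x _ =>
  (analyticAt_cexp.restrictScalars (𝕜 := ℝ)).comp ((linForm ζ).analyticAt x)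

lemma fderiv_expo (ζ : Fin d → ℂ) (x : EuclideanSpace ℝ (Fin d)) (j : Fin d) :
    fderiv ℝ (expo ζ) x (EuclideanSpace.single j (1 : ℝ)) = ζ j * expo ζ x := by
  have h : HasFDerivAt (expo ζ) (expo ζ x • linForm ζ) x := (linForm ζ).hasFDerivAt.cexp
  rw [h.fderiv]
  simp [linForm_single, mul_comm]

lemma partialDeriv_expo (J : Fin n → Fin d) (ζ : Fin d → ℂ) :
    partialDeriv J (expo ζ) = fun x => (∏ i, ζ (J i)) * expo ζ x := by
  induction n with
  | zero => simp [partialDeriv_zero]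
  | succ n ih =>
    rw [partialDeriv_succ J (contDiff_expo ζ), ih]
    ext x
    rw [fderiv_const_mul ((contDiff_expo ζ).differentiable (by simp) x), Fin.prod_univ_succ]
    simp only [smul_apply, fderiv_expo, smul_eq_mul, Fin.tail]
    ring

lemma expo_injective : Function.Injective (expo (d := d)) := by
  intro ζ ζ' h
  ext j
  have h1 := fderiv_expo ζ 0 j
  rw [h, fderiv_expo] at h1
  simpa [expo] using h1.symm

/-- Distinct characters of the additive group ℝ^d are independent (Dedekind, Artin). -/
theorem linearIndependent_expo : LinearIndependent ℂ (expo (d := d)) := by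
  let χ : (Fin d → ℂ) → (Multiplicative (EuclideanSpace ℝ (Fin d)) →* ℂ) := fun ζ =>
    { toFun := fun x => expo ζ x.toAdd
      map_one' := by simp [expo]
      map_mul' := fun x y => by simp [expo, Complex.exp_add] }
  have hχ : Function.Injective χ := fun ζ ζ' h => expo_injective <| by
    ext x
    exact DFunLike.congr_fun h (Multiplicative.ofAdd x)
  exact (linearIndependent_monoidHom (Multiplicative (EuclideanSpace ℝ (Fin d))) ℂ).comp χ hχ

/-- Exponentials with distinct exponents are linearly independent in `L²(Ω)`. -/
theorem linearIndependent_restr_expo (hne : (Ω : Set (EuclideanSpace ℝ (Fin d))).Nonempty)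
    (hb : Bornology.IsBounded (Ω : Set (EuclideanSpace ℝ (Fin d)))) :
    LinearIndependent ℂ fun ζ : Fin d → ℂ => restr hb (continuous_expo ζ) := by
  rw [linearIndependent_iff']
  intro s c hc
  have h0 : ∀ᵐ x ∂volume.restrict (Ω : Set (EuclideanSpace ℝ (Fin d))),
      ∑ ζ ∈ s, c ζ * expo ζ x = 0 := by
    have h1 := Lp.coeFn_finsetSum s fun ζ => c ζ • restr hb (continuous_expo ζ)
    rw [hc] at h1
    have h2 : ∀ᵐ x ∂volume.restrict (Ω : Set (EuclideanSpace ℝ (Fin d))), ∀ ζ ∈ s,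
        (c ζ • restr hb (continuous_expo ζ) : L2 Ω) x = c ζ * expo ζ x := by
      rw [Finset.eventually_all]
      intro ζ _
      filter_upwards [Lp.coeFn_smul (c ζ) (restr hb (continuous_expo ζ)),
        coeFn_restr hb (continuous_expo ζ)] with x h3 h4
      rw [h3, Pi.smul_apply, h4, smul_eq_mul]
    filter_upwards [h1, h2, Lp.coeFn_zero ℂ 2
      (volume.restrict (Ω : Set (EuclideanSpace ℝ (Fin d))))] with x h3 h4 h5
    rw [← Finset.sum_congr rfl h4, ← Finset.sum_apply, ← h3, h5]
    rfl
  -- The relation passes from almost everywhere to all of Ω by continuity, then to ℝ^d by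
  -- analyticity.
  have han : AnalyticOnNhd ℝ (fun x => ∑ ζ ∈ s, c ζ * expo ζ x) Set.univ := fun x hx =>
    Finset.analyticAt_fun_sum _ fun ζ _ => analyticAt_const.mul (analyticOnNhd_expo ζ x hx)
  have h1 : Set.EqOn (fun x => ∑ ζ ∈ s, c ζ * expo ζ x) 0 (Ω : Set (EuclideanSpace ℝ (Fin d))) :=
    Measure.eqOn_open_of_ae_eq h0 Ω.isOpen
      (continuous_finsetSum _ fun ζ _ => continuous_const.mul (continuous_expo ζ)).continuousOn
      continuousOn_const
  obtain ⟨x₀, hx₀⟩ := hne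
  have h2 : (fun x => ∑ ζ ∈ s, c ζ * expo ζ x) = 0 :=
    han.eq_of_eventuallyEq (z₀ := x₀) analyticOnNhd_const
      (Filter.eventually_of_mem (Ω.isOpen.mem_nhds hx₀) h1)
  refine linearIndependent_iff'.1 linearIndependent_expo s c ?_
  rw [← h2]
  ext x
  simp

/-- The symbol of ∑_J ∂_J² is that of Δ^m. -/
lemma sum_prod_sq (ζ : Fin d → ℂ) (m : ℕ) :
    ∑ J : Fin m → Fin d, (∏ i, ζ (J i)) * ∏ i, ζ (J i) = (∑ j, ζ j ^ 2) ^ m := by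
  have h := Finset.sum_pow' (Finset.univ : Finset (Fin d)) (fun j => ζ j ^ 2) m
  rw [h, Fintype.piFinset_univ]
  refine Finset.sum_congr rfl fun J _ => ?_
  rw [← Finset.prod_mul_distrib]
  exact Finset.prod_congr rfl fun i _ => (sq _).symm

/-- Exponentials solve `(-Δ)^m w = (-∑ ζ_j²)^m w`, tested against `H^m_0(Ω)`. -/
theorem inner_topDeriv_expo (hb : Bornology.IsBounded (Ω : Set (EuclideanSpace ℝ (Fin d))))
    (ζ : Fin d → ℂ) {w : Sobolev Ω m} (hw : w ∈ Sobolev0 Ω m) :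
    ⟪topDeriv Ω m w, topDeriv Ω m (ofSmooth hb m (contDiff_expo ζ))⟫_ℂ =
      (-∑ j, ζ j ^ 2) ^ m * ⟪toL2 Ω m w, toL2 Ω m (ofSmooth hb m (contDiff_expo ζ))⟫_ℂ := by
  refine closure_minimal (s := (testSubspace Ω m : Set (Sobolev Ω m)))
    (t := {w | ⟪topDeriv Ω m w, topDeriv Ω m (ofSmooth hb m (contDiff_expo ζ))⟫_ℂ =
      (-∑ j, ζ j ^ 2) ^ m * ⟪toL2 Ω m w, toL2 Ω m (ofSmooth hb m (contDiff_expo ζ))⟫_ℂ})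
    (fun w hw => ?_) (isClosed_eq (continuous_topDeriv.inner continuous_const)
      (continuous_const.mul (continuous_toL2.inner continuous_const))) hw
  obtain ⟨φ, rfl⟩ := exists_eq_ofSmooth hb hw
  -- One factor ∏ ζ comes from differentiating the exponential, the other from moving ∂_J off the
  -- test function.
  have key : ∀ J : Fin m → Fin d, ⟪topDeriv Ω m (ofSmooth hb m φ.contDiff) J,
      topDeriv Ω m (ofSmooth hb m (contDiff_expo ζ)) J⟫_ℂ = (-1) ^ m *
      ((∏ i, ζ (J i)) * (∏ i, ζ (J i)) *
      ⟪toL2 Ω m (ofSmooth hb m φ.contDiff), toL2 Ω m (ofSmooth hb m (contDiff_expo ζ))⟫_ℂ) := by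
    intro J
    have hJ := setIntegral_partialDeriv J (contDiff_expo ζ) (conjTest φ)
    have e1 : ⟪topDeriv Ω m (ofSmooth hb m φ.contDiff) J,
        topDeriv Ω m (ofSmooth hb m (contDiff_expo ζ)) J⟫_ℂ =
        (∏ i, ζ (J i)) * ∫ x in (Ω : Set (EuclideanSpace ℝ (Fin d))),
          expo ζ x * partialDeriv J (conjTest φ) x := by
      rw [topDeriv_ofSmooth, topDeriv_ofSmooth, inner_restr, ← integral_const_mul]
      refine integral_congr_ae ?_
      filter_upwards [coeFn_restr hb (contDiff_partialDeriv J (contDiff_expo ζ)).continuous]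
        with x hx
      rw [hx, partialDeriv_expo, ← partialDeriv_conj J φ.contDiff, mul_assoc]
      rfl
    have e2 : ∫ x in (Ω : Set (EuclideanSpace ℝ (Fin d))), partialDeriv J (expo ζ) x * conjTest φ x =
        (∏ i, ζ (J i)) * ⟪toL2 Ω m (ofSmooth hb m φ.contDiff),
          toL2 Ω m (ofSmooth hb m (contDiff_expo ζ))⟫_ℂ := by
      rw [toL2_ofSmooth, toL2_ofSmooth, inner_restr, ← integral_const_mul]
      refine integral_congr_ae ?_
      filter_upwards [coeFn_restr hb (contDiff_expo ζ).continuous] with x hx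
      rw [hx, partialDeriv_expo, conjTest_apply, mul_assoc]
    rw [e1, hJ, e2]
    ring
  change ⟪_, _⟫_ℂ = _
  rw [PiLp.inner_apply, Finset.sum_congr rfl fun J _ => key J, ← Finset.mul_sum, ← Finset.sum_mul,
    sum_prod_sq, neg_pow (∑ j, ζ j ^ 2), mul_assoc]

/-- A function in `L²(Ω)` whose Fourier transform vanishes off a sphere is zero. -/
theorem eq_zero_of_inner_expo (hd : 0 < d)
    (hb : Bornology.IsBounded (Ω : Set (EuclideanSpace ℝ (Fin d)))) {u : L2 Ω} {r : ℝ}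
    (h : ∀ ξ : EuclideanSpace ℝ (Fin d), ‖ξ‖ ≠ r →
      ⟪restr hb (continuous_expo fun j => Complex.I * ξ j), u⟫_ℂ = 0) : u = 0 := by
  have : Nonempty (Fin d) := ⟨⟨0, hd⟩⟩
  have : IsFiniteMeasure (volume.restrict (Ω : Set (EuclideanSpace ℝ (Fin d)))) :=
    ⟨by simpa using hb.measure_lt_top⟩
  have hu : IntegrableOn u (Ω : Set (EuclideanSpace ℝ (Fin d))) :=
    (Lp.memLp u).integrable (by norm_num)
  have hΩ := Ω.isOpen.measurableSet
  let f : EuclideanSpace ℝ (Fin d) → ℂ := (Ω : Set (EuclideanSpace ℝ (Fin d))).indicator u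
  have hf : Integrable f := (integrable_indicator_iff hΩ).2 hu
  have hF : ∀ w : EuclideanSpace ℝ (Fin d), ‖w‖ ≠ r / (2 * Real.pi) →
      FourierTransform.fourier f w = 0 := by
    intro w hw
    -- The Fourier kernel is exp(-2πi⟨x, w⟩), hence the rescaled frequency.
    have h1 := h ((2 * Real.pi) • w) fun h2 => hw (by
      rw [norm_smul, Real.norm_of_nonneg (by positivity)] at h2
      rw [← h2]
      field_simp)
    rw [inner_restr, ← integral_indicator hΩ] at h1
    rw [Real.fourier_eq', ← h1]
    refine integral_congr_ae (Eventually.of_forall fun x => ?_)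
    by_cases hx : x ∈ (Ω : Set (EuclideanSpace ℝ (Fin d)))
    · simp only [f, Set.indicator_of_mem hx, smul_eq_mul]
      rw [mul_comm, expo, ← Complex.exp_conj, linForm_apply]
      congr 2
      simp [PiLp.inner_apply, Finset.mul_sum, Finset.sum_mul, Complex.conj_ofNat]
      refine Finset.sum_congr rfl fun j _ => ?_
      ring
    · simp [f, Set.indicator_of_notMem hx]
  have hae : ∀ᵐ w : EuclideanSpace ℝ (Fin d), FourierTransform.fourier f w = 0 := by
    have h1 := Measure.addHaar_sphere (volume : Measure (EuclideanSpace ℝ (Fin d))) 0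
      (r / (2 * Real.pi))
    filter_upwards [measure_eq_zero_iff_ae_notMem.1 h1] with w hw
    exact hF w fun h2 => hw (by simpa using h2)
  refine eq_zero_of_forall_testFunction hb fun φ => ?_
  let Φ : SchwartzMap (EuclideanSpace ℝ (Fin d)) ℂ := φ.hasCompactSupport.toSchwartzMap φ.contDiff
  let g : SchwartzMap (EuclideanSpace ℝ (Fin d)) ℂ := FourierTransformInv.fourierInv Φ
  have hg : FourierTransform.fourier (g : EuclideanSpace ℝ (Fin d) → ℂ) = φ := by
    rw [← SchwartzMap.fourier_coe]
    simp only [g, FourierTransform.fourier_fourierInv_eq]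
    rfl
  -- The multiplication formula with ĝ = φ tests `f` against φ without inverting the transform of
  -- `f`.
  have key : ∫ w, FourierTransform.fourier f w • g w =
      ∫ x, f x • FourierTransform.fourier (g : EuclideanSpace ℝ (Fin d) → ℂ) x := by
    simpa using! VectorFourier.integral_fourierIntegral_smul_eq_flip
      (L := innerₗ (EuclideanSpace ℝ (Fin d))) Real.continuous_fourierChar continuous_inner hf
      g.integrable
  rw [hg] at key
  rw [integral_eq_zero_of_ae (by filter_upwards [hae] with w hw; simp [hw])] at key
  rw [← integral_indicator hΩ, key]
  refine integral_congr_ae (Eventually.of_forall fun x => ?_)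
  by_cases hx : x ∈ (Ω : Set (EuclideanSpace ℝ (Fin d)))
  · simp [f, Set.indicator_of_mem hx]
  · simp [f, Set.indicator_of_notMem hx]

end Exponentials

/-! ### Abstract variational principle, with `T` for the embedding and `D` for D^m. -/

section Variational

variable {X P G ι : Type*} [AddCommGroup X] [Module ℂ X]
  [NormedAddCommGroup P] [InnerProductSpace ℂ P] [NormedAddCommGroup G] [InnerProductSpace ℂ G]
  {T : X →ₗ[ℂ] G} {D : X →ₗ[ℂ] P} {e : ι → X} {μ : ι → ℝ}

lemma inner_map_sum_smul (s : Finset ι) (c : ι → ℂ) {φ : X}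
    (he : ∀ n ∈ s, ⟪D φ, D (e n)⟫_ℂ = μ n * ⟪T φ, T (e n)⟫_ℂ) :
    ⟪D φ, D (∑ n ∈ s, c n • e n)⟫_ℂ = ∑ n ∈ s, c n * (μ n * ⟪T φ, T (e n)⟫_ℂ) := by
  rw [map_sum, inner_sum]
  refine Finset.sum_congr rfl fun n hn => ?_
  rw [map_smul, inner_smul_right, he n hn]

lemma inner_orthonormal_sum_smul (hon : Orthonormal ℂ fun n => T (e n)) {s : Finset ι} (c : ι → ℂ)
    {n : ι} (hn : n ∈ s) : ⟪T (e n), T (∑ i ∈ s, c i • e i)⟫_ℂ = c n := by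
  simp only [map_sum, map_smul]
  exact hon.inner_right_sum c hn

/-- The eigenvalue relation is required only among the `e n` themselves, so this also covers
Dirichlet eigenfunctions, which cannot be tested against all of H^m. -/
lemma norm_sq_map_sum_smul_of_eigen (hon : Orthonormal ℂ fun n => T (e n)) (s : Finset ι) (c : ι → ℂ)
    (he : ∀ n ∈ s, ∀ i ∈ s, ⟪D (e i), D (e n)⟫_ℂ = μ n * ⟪T (e i), T (e n)⟫_ℂ) :
    ‖D (∑ n ∈ s, c n • e n)‖ ^ 2 = ∑ n ∈ s, μ n * ‖c n‖ ^ 2 := by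
  have h : ((‖D (∑ n ∈ s, c n • e n)‖ ^ 2 : ℝ) : ℂ) = ((∑ n ∈ s, μ n * ‖c n‖ ^ 2 : ℝ) : ℂ) := by
    have h1 := inner_self_eq_norm_sq_to_K (𝕜 := ℂ) (D (∑ n ∈ s, c n • e n))
    push_cast
    refine h1.symm.trans ?_
    rw [inner_map_sum_smul (T := T) (μ := μ) s c fun n hn => ?_]
    · refine Finset.sum_congr rfl fun n hn => ?_
      rw [← inner_conj_symm, inner_orthonormal_sum_smul hon c hn, mul_left_comm, Complex.mul_conj']
    · simp only [map_sum, map_smul, sum_inner, inner_smul_left, Finset.mul_sum]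
      refine Finset.sum_congr rfl fun i hi => ?_
      rw [he n hn i hi]
      ring
  exact_mod_cast h

lemma norm_sq_map_sum_smul (hon : Orthonormal ℂ fun n => T (e n)) (s : Finset ι) (c : ι → ℂ) :
    ‖T (∑ n ∈ s, c n • e n)‖ ^ 2 = ∑ n ∈ s, ‖c n‖ ^ 2 := by
  have h := norm_sq_map_sum_smul_of_eigen (D := T) (μ := fun _ => 1) hon s c (by simp)
  simpa using h

/-- Bessel's identity for the form of `D`: the `e n` are orthogonal for it too. Nonnegativity of the
left side replaces any convergence of the expansion under `D`. -/
lemma norm_sq_sub_sum_smul (hon : Orthonormal ℂ fun n => T (e n))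
    (he : ∀ n φ, ⟪D φ, D (e n)⟫_ℂ = μ n * ⟪T φ, T (e n)⟫_ℂ) (s : Finset ι) (u : X) :
    ‖D (u - ∑ n ∈ s, ⟪T (e n), T u⟫_ℂ • e n)‖ ^ 2 =
      ‖D u‖ ^ 2 - ∑ n ∈ s, μ n * ‖⟪T (e n), T u⟫_ℂ‖ ^ 2 := by
  have h1 : ⟪D u, D (∑ n ∈ s, ⟪T (e n), T u⟫_ℂ • e n)⟫_ℂ =
      ((∑ n ∈ s, μ n * ‖⟪T (e n), T u⟫_ℂ‖ ^ 2 : ℝ) : ℂ) := by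
    rw [inner_map_sum_smul s _ fun n _ => he n u]
    push_cast
    refine Finset.sum_congr rfl fun n _ => ?_
    rw [← inner_conj_symm (T u), mul_left_comm, Complex.mul_conj']
  rw [map_sub, norm_sub_sq (𝕜 := ℂ), h1,
    norm_sq_map_sum_smul_of_eigen hon s _ fun n _ i _ => he n (e i)]
  simp only [RCLike.re_eq_complex_re, Complex.ofReal_re]
  ring

variable {e : ℕ → X} {μ : ℕ → ℝ}

/-- The variational lower bound on the orthogonal complement of the first eigenfunctions. -/
theorem add_le_norm_sq_of_orthogonal [CompleteSpace G] (hon : Orthonormal ℂ fun n => T (e n))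
    (hspan : (Submodule.span ℂ (Set.range fun n => T (e n))).topologicalClosure = ⊤)
    (he : ∀ n φ, ⟪D φ, D (e n)⟫_ℂ = μ n * ⟪T φ, T (e n)⟫_ℂ) {N : ℕ} {l : ℝ}
    (hl : ∀ n, N ≤ n → l ≤ μ n) {u : X} (hu : ∀ n < N, ⟪T (e n), T u⟫_ℂ = 0) (n₀ : ℕ) :
    l * ‖T u‖ ^ 2 + (μ n₀ - l) * ‖⟪T (e n₀), T u⟫_ℂ‖ ^ 2 ≤ ‖D u‖ ^ 2 := by
  have hsum : HasSum (fun n => ‖⟪T (e n), T u⟫_ℂ‖ ^ 2) (‖T u‖ ^ 2) := by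
    let b := HilbertBasis.mk hon hspan.ge
    have h1 := b.hasSum_inner_mul_inner (T u) (T u)
    have h2 := h1.mapL Complex.reCLM
    rw [inner_self_eq_norm_sq_to_K] at h2
    convert h2 using 1
    · ext n
      simp only [b, HilbertBasis.coe_mk, Complex.reCLM_apply]
      rw [← inner_conj_symm (T u), Complex.conj_mul']
      norm_cast
    · simp only [Complex.reCLM_apply]
      norm_cast
  refine le_of_tendsto ((hsum.tendsto_sum_nat.const_mul l).add_const _) ?_
  filter_upwards [eventually_gt_atTop n₀] with M hM
  have h1 := norm_sq_sub_sum_smul hon he (Finset.range M) u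
  -- The `if` term keeps the excess of the single mode `n₀`, which the equality case needs.
  have h2 : ∑ n ∈ Finset.range M, (l * ‖⟪T (e n), T u⟫_ℂ‖ ^ 2 +
      if n = n₀ then (μ n₀ - l) * ‖⟪T (e n₀), T u⟫_ℂ‖ ^ 2 else 0) ≤
      ∑ n ∈ Finset.range M, μ n * ‖⟪T (e n), T u⟫_ℂ‖ ^ 2 := by
    refine Finset.sum_le_sum fun n _ => ?_
    split_ifs with hn
    · rw [hn]
      linarith
    · by_cases hnN : n < N
      · simp [hu n hnN]
      · rw [add_zero]
        exact mul_le_mul_of_nonneg_right (hl n (not_lt.1 hnN)) (by positivity)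
  rw [Finset.sum_add_distrib, ← Finset.mul_sum, Finset.sum_ite_eq',
    if_pos (Finset.mem_range.2 hM)] at h2
  linarith [sq_nonneg ‖D (u - ∑ n ∈ Finset.range M, ⟪T (e n), T u⟫_ℂ • e n)‖]

/-- Equality in the variational lower bound only holds for eigenfunctions. -/
theorem eigen_of_norm_sq_le [CompleteSpace G] (hon : Orthonormal ℂ fun n => T (e n))
    (hspan : (Submodule.span ℂ (Set.range fun n => T (e n))).topologicalClosure = ⊤)
    (he : ∀ n φ, ⟪D φ, D (e n)⟫_ℂ = μ n * ⟪T φ, T (e n)⟫_ℂ) {N M : ℕ} {l : ℝ}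
    (hl : ∀ n, N ≤ n → l ≤ μ n) (hM : ∀ n, M ≤ n → l < μ n) {u : X}
    (hu : ∀ n < N, ⟪T (e n), T u⟫_ℂ = 0) (hle : ‖D u‖ ^ 2 ≤ l * ‖T u‖ ^ 2) :
    (∀ φ, ⟪D φ, D u⟫_ℂ = l * ⟪T φ, T u⟫_ℂ) ∧
      T u ∈ Submodule.span ℂ ((fun n => T (e n)) '' Set.Iio M) := by
  have hc : ∀ n, ⟪T (e n), T u⟫_ℂ = 0 ∨ μ n = l := fun n => by
    by_cases hn : n < N
    · exact Or.inl (hu n hn)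
    rcases (hl n (not_lt.1 hn)).lt_or_eq with h | h
    · left
      have h1 := add_le_norm_sq_of_orthogonal hon hspan he hl hu n
      have h2 : (μ n - l) * ‖⟪T (e n), T u⟫_ℂ‖ ^ 2 ≤ 0 := by linarith
      have h3 : ‖⟪T (e n), T u⟫_ℂ‖ ^ 2 ≤ 0 := nonpos_of_mul_nonpos_right h2 (sub_pos.2 h)
      simpa using le_antisymm h3 (sq_nonneg _)
    · exact Or.inr h.symm
  set y : X := ∑ n ∈ Finset.range M, ⟪T (e n), T u⟫_ℂ • e n with hy
  -- Only modes with `μ n = l` survive, and these have `n < M`; hence `u` and the finite sum `y`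
  -- have the same coefficients.
  have hTy : T u = T y := by
    have h1 : Submodule.span ℂ (Set.range fun n => T (e n)) ≤ (ℂ ∙ (T u - T y))ᗮ := by
      rw [Submodule.span_le]
      rintro _ ⟨n, rfl⟩
      rw [SetLike.mem_coe, Submodule.mem_orthogonal_singleton_iff_inner_left, inner_sub_right,
        sub_eq_zero]
      by_cases hn : n < M
      · exact (inner_orthonormal_sum_smul hon (fun n => ⟪T (e n), T u⟫_ℂ)
          (Finset.mem_range.2 hn)).symm
      · rw [(hc n).resolve_right (hM n (not_lt.1 hn)).ne', hy]
        simp only [map_sum, map_smul, inner_sum, inner_smul_right]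
        refine (Finset.sum_eq_zero fun i hi => ?_).symm
        have hne : n ≠ i := fun h => hn (h ▸ Finset.mem_range.1 hi)
        rw [hon.2 hne, mul_zero]
    rw [← sub_eq_zero, ← Submodule.mem_bot ℂ,
      ← Submodule.topologicalClosure_eq_top_iff.1 hspan]
    exact fun w hw => Submodule.mem_orthogonal_singleton_iff_inner_left.1 (h1 hw)
  -- Since `T` is not assumed injective, this needs its own argument: by Bessel's identity ‖D(u -
  -- y)‖² = ‖D u‖² - l‖T u‖² ≤ 0.
  have hDy : D u = D y := by
    rw [← sub_eq_zero, ← map_sub, ← norm_eq_zero, ← sq_eq_zero_iff]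
    refine le_antisymm ?_ (sq_nonneg _)
    rw [hy, norm_sq_sub_sum_smul hon he]
    have h1 := norm_sq_map_sum_smul hon (Finset.range M) fun n => ⟪T (e n), T u⟫_ℂ
    rw [← hy, ← hTy] at h1
    have h2 : ∑ n ∈ Finset.range M, μ n * ‖⟪T (e n), T u⟫_ℂ‖ ^ 2 = l * ‖T u‖ ^ 2 := by
      rw [h1, Finset.mul_sum]
      refine Finset.sum_congr rfl fun n _ => ?_
      rcases hc n with h | h <;> simp [h]
    linarith
  refine ⟨fun φ => ?_, ?_⟩
  · rw [hDy, hy, inner_map_sum_smul _ _ fun n _ => he n φ]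
    conv_rhs => rw [hTy, hy, map_sum, inner_sum, Finset.mul_sum]
    refine Finset.sum_congr rfl fun n _ => ?_
    rw [map_smul, inner_smul_right]
    rcases hc n with h | h
    · simp [h]
    · rw [h]
      ring
  · rw [hTy, hy, map_sum]
    refine Submodule.sum_mem _ fun n hn => ?_
    rw [map_smul]
    exact Submodule.smul_mem _ _ (Submodule.subset_span ⟨n, Finset.mem_range.1 hn, rfl⟩)

end Variational

/-! ### The trial space and the strict inequality. -/

section Comparison

open scoped ContDiff

variable {d m : ℕ} {Ω : Opens (EuclideanSpace ℝ (Fin d))}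

theorem infinite_dimensional_L2 (hd : 0 < d)
    (hne : (Ω : Set (EuclideanSpace ℝ (Fin d))).Nonempty)
    (hb : Bornology.IsBounded (Ω : Set (EuclideanSpace ℝ (Fin d)))) :
    ¬ FiniteDimensional ℂ (L2 Ω) := fun _ => by
  have : Nonempty (Fin d) := ⟨⟨0, hd⟩⟩
  have := (linearIndependent_restr_expo hne hb).finite_of_isNoetherian
  exact not_finite (Fin d → ℂ)

/-- There are infinitely many pairwise linearly independent unit vectors in dimension at least
two. -/
lemma exists_unit_vectors (hd : 2 ≤ d) : ∃ θ : ℕ → Fin d → ℝ, (∀ N, ∑ j, θ N j ^ 2 = 1) ∧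
    ∃ i₀ i₁, ∀ N, θ N i₀ ≠ 0 ∧ θ N i₁ = N * θ N i₀ := by
  let i₀ : Fin d := ⟨0, by omega⟩
  let i₁ : Fin d := ⟨1, by omega⟩
  have h10 : i₁ ≠ i₀ := by simp [i₀, i₁]
  have hs : ∀ N : ℕ, 0 < √(1 + (N : ℝ) ^ 2) := fun N => by positivity
  -- The normalized vectors (1, N, 0, …, 0), told apart by their slope N.
  refine ⟨fun N j => ((if j = i₀ then 1 else 0) + if j = i₁ then (N : ℝ) else 0) / √(1 + (N : ℝ) ^ 2),
    fun N => ?_, i₀, i₁, fun N => ⟨?_, ?_⟩⟩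
  · have h : ∀ j, (((if j = i₀ then 1 else 0) + if j = i₁ then (N : ℝ) else 0) /
        √(1 + (N : ℝ) ^ 2)) ^ 2 =
        ((if j = i₀ then 1 else 0) + if j = i₁ then (N : ℝ) ^ 2 else 0) / (1 + (N : ℝ) ^ 2) := by
      intro j
      rw [div_pow, Real.sq_sqrt (by positivity)]
      congr 1
      split_ifs with h1 h2
      · exact absurd (h2.symm.trans h1) h10
      all_goals simp
    rw [Finset.sum_congr rfl fun j _ => h j, ← Finset.sum_div, Finset.sum_add_distrib,
      Finset.sum_ite_eq', Finset.sum_ite_eq']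
    simp only [Finset.mem_univ, if_true]
    exact div_self (by positivity)
  · simp only [if_pos, if_neg h10.symm, add_zero]
    have := hs N
    positivity
  · simp only [if_pos, if_neg h10.symm, if_neg h10, add_zero, zero_add]
    ring

/-- The `m` distinct solutions of `κ ^ m = I ^ m * √l`. -/
lemma exists_roots (hm : 1 ≤ m) {l : ℝ} (hl : 0 < l) : ∃ κ : Fin m → ℂ, Function.Injective κ ∧
    (∀ j, κ j ≠ 0) ∧ ∀ j, κ j ^ m = Complex.I ^ m * (√l : ℝ) := by
  have hl' : ((√l : ℝ) : ℂ) ≠ 0 := by exact_mod_cast (Real.sqrt_pos.2 hl).ne'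
  obtain ⟨α, hα⟩ := IsAlgClosed.exists_pow_nat_eq (Complex.I ^ m * (√l : ℝ)) hm
  have hξ := Complex.isPrimitiveRoot_exp m (by omega)
  have hα0 : α ≠ 0 := fun h => by
    rw [h, zero_pow (by omega)] at hα
    exact (mul_ne_zero (pow_ne_zero _ Complex.I_ne_zero) hl') hα.symm
  refine ⟨fun j => α * Complex.exp (2 * Real.pi * Complex.I / m) ^ (j : ℕ), fun i j hij => ?_,
    fun j => mul_ne_zero hα0 (pow_ne_zero _ (Complex.exp_ne_zero _)), fun j => ?_⟩
  · exact Fin.ext (hξ.pow_inj i.2 j.2 (mul_left_cancel₀ hα0 hij))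
  · rw [mul_pow, hα, pow_right_comm, hξ.pow_eq_one, one_pow, mul_one]

lemma topDeriv_ofSmooth_expo (hb : Bornology.IsBounded (Ω : Set (EuclideanSpace ℝ (Fin d))))
    (ζ : Fin d → ℂ) (J : Fin m → Fin d) :
    topDeriv Ω m (ofSmooth hb m (contDiff_expo ζ)) J =
      (∏ i, ζ (J i)) • toL2 Ω m (ofSmooth hb m (contDiff_expo ζ)) := by
  rw [topDeriv_ofSmooth, toL2_ofSmooth]
  refine Lp.ext ?_
  filter_upwards [coeFn_restr hb (contDiff_partialDeriv J (contDiff_expo ζ)).continuous,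
    coeFn_restr hb (continuous_expo ζ),
    Lp.coeFn_smul (∏ i, ζ (J i)) (restr hb (continuous_expo ζ))] with x h1 h2 h3
  rw [h1, h3, Pi.smul_apply, h2, partialDeriv_expo, smul_eq_mul]

/-- For solutions `w` of `(d/dt)^m f = C f` in the direction of a unit vector,
`|D^m w|² = |C|² |w|²`. -/
theorem norm_sq_topDeriv_sum_expo (hb : Bornology.IsBounded (Ω : Set (EuclideanSpace ℝ (Fin d))))
    {θ : Fin d → ℝ} (hθ : ∑ j, θ j ^ 2 = 1) {κ : Fin m → ℂ} {C : ℂ} (hκ : ∀ j, κ j ^ m = C)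
    (c : Fin m → ℂ) :
    ‖topDeriv Ω m (∑ j, c j • ofSmooth hb m (contDiff_expo fun i => κ j * θ i))‖ ^ 2 =
      ‖C‖ ^ 2 * ‖toL2 Ω m (∑ j, c j • ofSmooth hb m (contDiff_expo fun i => κ j * θ i))‖ ^ 2 := by
  -- All the exponentials share κ_j^m = C, so each derivative of order m multiplies the whole sum by
  -- one constant.
  have hJ : ∀ J : Fin m → Fin d,
      topDeriv Ω m (∑ j, c j • ofSmooth hb m (contDiff_expo fun i => κ j * θ i)) J =
      (C * ((∏ i, θ (J i) : ℝ) : ℂ)) •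
        toL2 Ω m (∑ j, c j • ofSmooth hb m (contDiff_expo fun i => κ j * θ i)) := by
    intro J
    rw [map_sum, map_sum, WithLp.ofLp_sum, Finset.sum_apply, Finset.smul_sum]
    refine Finset.sum_congr rfl fun j _ => ?_
    rw [map_smul, map_smul, PiLp.smul_apply, topDeriv_ofSmooth_expo, smul_comm,
      Finset.prod_mul_distrib, Finset.prod_const, Finset.card_univ, Fintype.card_fin, hκ]
    push_cast
    rfl
  have hsum : ∑ J : Fin m → Fin d, ‖∏ i, θ (J i)‖ ^ 2 = 1 := by
    have h := Finset.sum_pow' (Finset.univ : Finset (Fin d)) (fun j => θ j ^ 2) m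
    rw [hθ, one_pow, Fintype.piFinset_univ] at h
    rw [h]
    refine Finset.sum_congr rfl fun J _ => ?_
    rw [Real.norm_eq_abs, sq_abs, Finset.prod_pow]
  rw [PiLp.norm_sq_eq_of_L2]
  simp only [hJ, norm_smul, norm_mul, mul_pow, Complex.norm_real]
  rw [← Finset.sum_mul, ← Finset.mul_sum, hsum, mul_one]

/-- The factor i^m in the equation for κ cancels the sign: (-κ²)^m = (-1)^m (i^m √l)² = l. -/
lemma neg_sum_sq_pow {θ : Fin d → ℝ} (hθ : ∑ j, θ j ^ 2 = 1) {l : ℝ} (hl : 0 ≤ l) {κ : ℂ}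
    (hκ : κ ^ m = Complex.I ^ m * (√l : ℝ)) : (-∑ i, (κ * θ i) ^ 2) ^ m = l := by
  have h1 : ∑ i, (κ * θ i) ^ 2 = κ ^ 2 := by
    simp only [mul_pow]
    rw [← Finset.mul_sum]
    have : ((∑ j, θ j ^ 2 : ℝ) : ℂ) = 1 := by rw [hθ]; simp
    push_cast at this
    rw [this, mul_one]
  rw [h1, neg_pow, ← pow_mul, mul_comm 2, pow_mul, hκ, mul_pow, ← pow_mul, mul_comm m, pow_mul,
    Complex.I_sq, ← mul_assoc, ← mul_pow]
  norm_cast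
  rw [Real.sq_sqrt hl]
  simp

/-- A function in `H^m_0(Ω)` that is also a Neumann eigenfunction vanishes. -/
theorem toL2_eq_zero_of_dirichlet_of_neumann (hd : 0 < d) (hm : 1 ≤ m)
    (hb : Bornology.IsBounded (Ω : Set (EuclideanSpace ℝ (Fin d)))) {l : ℝ} (hl : 0 ≤ l)
    {v : Sobolev Ω m} (hv : v ∈ Sobolev0 Ω m)
    (hN : ∀ φ, ⟪topDeriv Ω m φ, topDeriv Ω m v⟫_ℂ = l * ⟪toL2 Ω m φ, toL2 Ω m v⟫_ℂ) :
    toL2 Ω m v = 0 := by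
  have hr : (l ^ ((2 * m : ℕ) : ℝ)⁻¹) ^ (2 * m) = l :=
    Real.rpow_inv_natCast_pow hl (by omega)
  -- Comparing the Neumann equation tested with a plane wave and integration by parts for v ∈ H^m_0
  -- gives (|ξ|^{2m} - l) v̂(ξ) = 0.
  refine eq_zero_of_inner_expo hd hb (r := l ^ ((2 * m : ℕ) : ℝ)⁻¹) fun ξ hξ => ?_
  set w := ofSmooth hb m (contDiff_expo fun j => Complex.I * ξ j) with hw
  have h1 := inner_topDeriv_expo hb (fun j => Complex.I * ξ j) hv
  have h2 := congrArg (starRingEnd ℂ) (hN w)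
  rw [← hw] at h1
  rw [map_mul, inner_conj_symm, inner_conj_symm, Complex.conj_ofReal, h1] at h2
  have h3 : (-∑ j, (Complex.I * (ξ j : ℂ)) ^ 2) ^ m = ((‖ξ‖ ^ (2 * m) : ℝ) : ℂ) := by
    rw [pow_mul, EuclideanSpace.real_norm_sq_eq]
    simp only [mul_pow, Complex.I_sq]
    push_cast
    congr 1
    simp
  rw [h3, ← sub_eq_zero, ← sub_mul, mul_eq_zero] at h2
  have h4 : ⟪toL2 Ω m v, toL2 Ω m w⟫_ℂ = 0 := by
    refine h2.resolve_left fun h => hξ ?_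
    have h5 : ‖ξ‖ ^ (2 * m) = l := by exact_mod_cast sub_eq_zero.1 h
    rw [← hr] at h5
    exact (pow_left_inj₀ (norm_nonneg _) (by positivity) (by omega)).1 h5
  rw [← inner_conj_symm, ← map_zero (starRingEnd ℂ), ← h4]
  rfl

/-- A family of nontrivial combinations of disjoint parts of a linearly independent family is
linearly independent. -/
lemma linearIndependent_sum_smul {ι κ V : Type*} [Fintype κ] [AddCommGroup V] [Module ℂ V]
    {b : ι × κ → V} (hb : LinearIndependent ℂ b) {c : ι → κ → ℂ} (hc : ∀ i, c i ≠ 0) :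
    LinearIndependent ℂ fun i => ∑ j, c i j • b (i, j) := by
  rw [linearIndependent_iff']
  intro s g hg i hi
  obtain ⟨j, hj⟩ := Function.ne_iff.1 (hc i)
  have h := linearIndependent_iff'.1 hb (s ×ˢ Finset.univ) (fun p => g p.1 * c p.1 p.2) (by
    rw [Finset.sum_product, ← hg]
    refine Finset.sum_congr rfl fun i _ => ?_
    rw [Finset.smul_sum]
    exact Finset.sum_congr rfl fun j _ => mul_smul _ _ _) (i, j) (by simp [hi])
  exact (mul_eq_zero.1 h).resolve_right hj

/-- The Poincaré inequality forbids D^m u = 0. Positivity is what makes the m roots κ_j distinct and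
nonzero. -/
lemma dirichlet_pos (hd : 0 < d) (hb : Bornology.IsBounded (Ω : Set (EuclideanSpace ℝ (Fin d))))
    {l : ℝ} {u : Sobolev Ω m} (hu : IsWeakSolution (Sobolev0 Ω m) l u) (h0 : ‖toL2 Ω m u‖ = 1) :
    0 < l := by
  obtain ⟨C, hC⟩ := exists_norm_toL2_le (m := m) hd hb
  have h1 := hu.2 u hu.1
  rw [inner_self_eq_norm_sq_to_K, inner_self_eq_norm_sq_to_K, h0] at h1
  have h2 : ‖topDeriv Ω m u‖ ^ 2 = l := by
    have : ((‖topDeriv Ω m u‖ ^ 2 : ℝ) : ℂ) = l := by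
      push_cast
      simpa using h1
    exact_mod_cast this
  have h3 := hC u hu.1
  rw [h0] at h3
  have h4 : topDeriv Ω m u ≠ 0 := fun h => by
    rw [h, norm_zero, mul_zero] at h3
    linarith
  rw [← h2]
  exact pow_pos (norm_pos_iff.2 h4) 2

theorem neumann_lt_dirichlet (hd : 2 ≤ d) (hm : 1 ≤ m)
    (hne : (Ω : Set (EuclideanSpace ℝ (Fin d))).Nonempty)
    (hb : Bornology.IsBounded (Ω : Set (EuclideanSpace ℝ (Fin d)))) {lam mu : ℕ → ℝ}
    (hlam : IsDirichletSpectrum Ω m lam) (hmu : IsNeumannSpectrum Ω m mu) (k : ℕ) :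
    mu (k + m) < lam k := by
  by_contra! hcon
  obtain ⟨f, hf, hfon, -⟩ := hlam.exists_basis
  obtain ⟨e, he, heon, hespan⟩ := hmu.exists_basis
  have he' : ∀ n φ, ⟪topDeriv Ω m φ, topDeriv Ω m (e n)⟫_ℂ =
      mu n * ⟪toL2 Ω m φ, toL2 Ω m (e n)⟫_ℂ := fun n φ => (he n).2 φ trivial
  have hl : 0 < lam k := dirichlet_pos (by omega) hb (hf k) (hfon.1 k)
  obtain ⟨M, hM⟩ := (hmu.tendsto.eventually_gt_atTop (lam k)).exists_forall_of_atTop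
  obtain ⟨κ, hκinj, hκ0, hκ⟩ := exists_roots hm hl
  obtain ⟨θ, hθ, i₀, i₁, hθi⟩ := exists_unit_vectors hd
  let V : (Fin (k + 1) → ℂ) →ₗ[ℂ] Sobolev Ω m := Fintype.linearCombination ℂ fun i => f i
  let W : ℕ → (Fin m → ℂ) →ₗ[ℂ] Sobolev Ω m := fun N => Fintype.linearCombination ℂ
    fun j => ofSmooth hb m (contDiff_expo fun i => κ j * θ N i)
  have hVon : Orthonormal ℂ fun i : Fin (k + 1) => toL2 Ω m (f i) :=
    hfon.comp (fun i : Fin (k + 1) => (i : ℕ)) Fin.val_injective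
  have hVmem : ∀ a, V a ∈ Sobolev0 Ω m := fun a => by
    simp only [V, Fintype.linearCombination_apply]
    exact Submodule.sum_mem _ fun i _ => Submodule.smul_mem _ _ (hf i).1
  have hVT : ∀ a, ‖toL2 Ω m (V a)‖ ^ 2 = ∑ i, ‖a i‖ ^ 2 := fun a => by
    simp only [V, Fintype.linearCombination_apply]
    exact norm_sq_map_sum_smul hVon _ a
  have hVle : ∀ a, ‖topDeriv Ω m (V a)‖ ^ 2 ≤ lam k * ‖toL2 Ω m (V a)‖ ^ 2 := fun a => by
    rw [hVT, Finset.mul_sum]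
    simp only [V, Fintype.linearCombination_apply]
    rw [norm_sq_map_sum_smul_of_eigen (μ := fun i : Fin (k + 1) => lam i) hVon _ a
      fun n _ i _ => (hf n).2 _ (hf i).1]
    exact Finset.sum_le_sum fun i _ => mul_le_mul_of_nonneg_right
      (hlam.monotone (Nat.lt_succ_iff.1 i.2)) (by positivity)
  have hWle : ∀ N c, ‖topDeriv Ω m (W N c)‖ ^ 2 = lam k * ‖toL2 Ω m (W N c)‖ ^ 2 := fun N c => by
    simp only [W, Fintype.linearCombination_apply]
    rw [norm_sq_topDeriv_sum_expo hb (hθ N) hκ]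
    simp [Real.sq_sqrt hl.le]
  have hVW : ∀ N a c, ⟪topDeriv Ω m (V a), topDeriv Ω m (W N c)⟫_ℂ =
      lam k * ⟪toL2 Ω m (V a), toL2 Ω m (W N c)⟫_ℂ := fun N a c => by
    simp only [W, Fintype.linearCombination_apply, map_sum, inner_sum, map_smul, inner_smul_right,
      Finset.mul_sum]
    refine Finset.sum_congr rfl fun j _ => ?_
    rw [inner_topDeriv_expo hb _ (hVmem a), neg_sum_sq_pow (hθ N) hl.le (hκ j)]
    ring
  have hle : ∀ N a c, ‖topDeriv Ω m (V a + W N c)‖ ^ 2 ≤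
      lam k * ‖toL2 Ω m (V a + W N c)‖ ^ 2 := fun N a c => by
    rw [map_add, map_add, norm_add_sq (𝕜 := ℂ), norm_add_sq (𝕜 := ℂ), hVW, hWle]
    have h1 : RCLike.re ((lam k : ℂ) * ⟪toL2 Ω m (V a), toL2 Ω m (W N c)⟫_ℂ) =
        lam k * RCLike.re ⟪toL2 Ω m (V a), toL2 Ω m (W N c)⟫_ℂ := RCLike.re_ofReal_mul _ _
    rw [h1]
    linarith [hVle a]
  -- This space does not depend on the direction `N`.
  let Y : Submodule ℂ (L2 Ω) :=
    Submodule.span ℂ ((fun n => toL2 Ω m (e n)) '' Set.Iio M) ⊔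
      Submodule.span ℂ (Set.range fun i : Fin (k + 1) => toL2 Ω m (f i))
  have hYfin : FiniteDimensional ℂ Y := by
    have h1 : FiniteDimensional ℂ (Submodule.span ℂ ((fun n => toL2 Ω m (e n)) '' Set.Iio M)) :=
      FiniteDimensional.span_of_finite ℂ ((Set.finite_Iio M).image _)
    have h2 : FiniteDimensional ℂ
        (Submodule.span ℂ (Set.range fun i : Fin (k + 1) => toL2 Ω m (f i))) :=
      FiniteDimensional.span_of_finite ℂ (Set.finite_range _)
    exact Submodule.finiteDimensional_sup _ _
  have hVY : ∀ a, toL2 Ω m (V a) ∈ Y := fun a => by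
    simp only [V, Fintype.linearCombination_apply, map_sum, map_smul]
    exact Submodule.sum_mem _ fun i _ => Submodule.smul_mem _ _ <|
      Submodule.mem_sup_right (Submodule.subset_span ⟨i, rfl⟩)
  have key : ∀ N, ∃ c : Fin m → ℂ, c ≠ 0 ∧ toL2 Ω m (W N c) ∈ Y := by
    intro N
    let L : (Fin (k + 1) → ℂ) × (Fin m → ℂ) →ₗ[ℂ] Fin (k + m) → ℂ :=
      LinearMap.pi fun n => (innerSL ℂ (toL2 Ω m (e n)) : L2 Ω →ₗ[ℂ] ℂ) ∘ₗ toL2 Ω m ∘ₗ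
        LinearMap.coprod V (W N)
    -- There are k + 1 + m parameters, as indices start at 0, against k + m conditions.
    have hker : LinearMap.ker L ≠ ⊥ := LinearMap.ker_ne_bot_of_finrank_lt (by
      simp only [Module.finrank_prod, Module.finrank_fintype_fun_eq_card, Fintype.card_fin]
      omega)
    obtain ⟨⟨a, c⟩, hac, hac0⟩ := Submodule.exists_mem_ne_zero_of_ne_bot hker
    have horth : ∀ n < k + m, ⟪toL2 Ω m (e n), toL2 Ω m (V a + W N c)⟫_ℂ = 0 := fun n hn =>
      congrFun (LinearMap.mem_ker.1 hac) ⟨n, hn⟩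
    obtain ⟨heig, hmem⟩ := eigen_of_norm_sq_le heon hespan he' (N := k + m) (M := M) (l := lam k)
      (fun n hn => hcon.trans (hmu.monotone hn)) hM horth (hle N a c)
    refine ⟨c, fun hc => hac0 ?_, ?_⟩
    · rw [hc, map_zero, add_zero] at heig
      have h0 := toL2_eq_zero_of_dirichlet_of_neumann (by omega) hm hb hl.le (hVmem a) heig
      have h1 := hVT a
      rw [h0, norm_zero, zero_pow two_ne_zero, eq_comm,
        Finset.sum_eq_zero_iff_of_nonneg fun _ _ => by positivity] at h1
      have h2 : a = 0 := by
        ext i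
        simpa using h1 i (Finset.mem_univ i)
      rw [h2, hc]
      rfl
    · have h1 : toL2 Ω m (W N c) = toL2 Ω m (V a + W N c) - toL2 Ω m (V a) := by simp
      rw [h1]
      exact Submodule.sub_mem _ (Submodule.mem_sup_left hmem) (hVY a)
  choose c hc0 hcY using key
  -- The ratio of the entries `i₁` and `i₀` gives `N`, and then the entry `i₀` gives the root.
  have hζ : Function.Injective fun p : ℕ × Fin m => fun i => κ p.2 * (θ p.1 i : ℂ) := by
    rintro ⟨N, j⟩ ⟨N', j'⟩ h
    have h0 := congrFun h i₀
    have h1 := congrFun h i₁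
    simp only [(hθi _).2] at h0 h1
    have hne0 : κ j' * (θ N' i₀ : ℂ) ≠ 0 :=
      mul_ne_zero (hκ0 j') (by exact_mod_cast (hθi N').1)
    have hN : N = N' := by
      push_cast at h1
      rw [mul_left_comm, h0, mul_left_comm (κ j') (N' : ℂ)] at h1
      exact_mod_cast mul_right_cancel₀ hne0 h1
    subst hN
    have : κ j = κ j' := mul_right_cancel₀ (by exact_mod_cast (hθi N).1) h0
    rw [hκinj this]
  have hLI := linearIndependent_sum_smul ((linearIndependent_restr_expo hne hb).comp _ hζ) hc0
  have hLIY : LinearIndependent ℂ fun N => (⟨toL2 Ω m (W N (c N)), hcY N⟩ : Y) := by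
    refine LinearIndependent.of_comp Y.subtype ?_
    convert hLI using 1
    ext1 N
    simp only [W, Fintype.linearCombination_apply, Function.comp_apply, Submodule.subtype_apply,
      map_sum, map_smul, toL2_ofSmooth]
  have := hLIY.finite_of_isNoetherian
  exact not_finite ℕ

end Comparison

end Polyharmonic

theorem theorem1p1 {d : ℕ} (hd : 2 ≤ d) {m : ℕ} (hm : 1 ≤ m)
    (Ω : Opens (EuclideanSpace ℝ (Fin d)))
    (hconn : IsConnected (Ω : Set (EuclideanSpace ℝ (Fin d))))
    (hbdd : Bornology.IsBounded (Ω : Set (EuclideanSpace ℝ (Fin d))))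
    (hcompact : IsCompactOperator (Polyharmonic.toL2 Ω m)) :
    (∃ lam : ℕ → ℝ, Polyharmonic.IsDirichletSpectrum Ω m lam) ∧
    (CompleteSpace (Polyharmonic.Sobolev Ω m) →
      ∃ mu : ℕ → ℝ, Polyharmonic.IsNeumannSpectrum Ω m mu) ∧
    ∀ lam mu : ℕ → ℝ, Polyharmonic.IsDirichletSpectrum Ω m lam →
      Polyharmonic.IsNeumannSpectrum Ω m mu → ∀ k : ℕ, mu (k + m) < lam k := by
  have hinf := Polyharmonic.infinite_dimensional_L2 (by omega) hconn.nonempty hbdd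
  refine ⟨?_, fun hcomplete => ?_, fun lam mu hlam hmu k =>
    Polyharmonic.neumann_lt_dirichlet hd hm hconn.nonempty hbdd hlam hmu k⟩
  · have := Polyharmonic.completeSpace_sobolev0 (m := m) (by omega) hbdd
    exact Polyharmonic.exists_isEigenvalueSequence hcompact hinf _ fun u hu => Polyharmonic.dense_sobolev0 hbdd hu
  · have : CompleteSpace (⊤ : Submodule ℂ (Polyharmonic.Sobolev Ω m)) :=
      completeSpace_coe_iff_isComplete.2 (completeSpace_iff_isComplete_univ.1 hcomplete)
    exact Polyharmonic.exists_isEigenvalueSequence hcompact hinf _ fun u hu =>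
      Polyharmonic.dense_sobolev0 hbdd fun w _ => hu w trivial
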